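/- **Definitions.** A $d$-class association scheme $\mathfrak X=(X,\{R_i\}_{i=0}^d)$ is a finite set $X$ with nonempty relations $R_0,\dots,R_d$ that partition $X\times X$, such that $R_0$ is the diagonal, for every $i$ the transpose of $R_i$ is some $R_{i^*}$, and for all $i,j,l$ the number $p_{i,j}^l$ of $z\in X$ with $(x,z)\in R_i$ and $(z,y)\in R_j$ is the same for all $(x,y)\in R_l$. It is commutative if $p_{i,j}^l=p_{j,i}^l$ for all $i,j,l$. The valency of $R_i$ is $k_i=p_{i,i^*}^0$, and $R_i$ is non-symmetric if $i\ne i^*$. Put $R_iR_j=\{R_l : p_{i,j}^l\neq 0\}$ and $R_i^2=R_iR_i$. A set $F$ of relations is closed if $R_{i^*}R_j\subseteq F$ for all $R_i,R_j\in F$, and $R_j$ generates $\mathfrak X$ if the smallest closed set containing $R_j$ is $\{R_0,\dots,R_d\}$. A commutative scheme is pseudocyclic if all primitive idempotents, other than $\frac1{|X|}J$ ($J$ the all-one matrix), of the complex algebra generated by the adjacency matrices of $R_0,\dots,R_d$ have the same rank. Two schemes are isomorphic if some bijection between their point sets maps the relations of the one onto the relations of the other, in some order. Finally, $\mathrm{Cyc}(13,4)$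 is the $4$-class scheme on $\mathrm{GF}(13)$ in which $R_0$ is the diagonal and, for $1\le i\le 4$, $(x,y)\in R_i$ if and only if $x-y\in\alpha^i\langle\alpha^4\rangle$, where $\alpha$ is a primitive element of $\mathrm{GF}(13)$ (up to isomorphism, the choice of $\alpha$ does not matter). **Theorem 1.1.** Let $\mathfrak X=(X,\{R_i\}_{i=0}^d)$ be a commutative association scheme generated by a non-symmetric relation $R_1$ with $k_1>1$, satisfying $$R_1^2\subseteq\{R_1,R_{1^*},R_2\},\qquad R_1R_{1^*}\subseteq\{R_0,R_1,R_{1^*},R_2,R_{2^*}\},\qquad 2\notin\{1^*,2^*\}.$$ If $k_1\ge k_2$, then $d=4$. If moreover $\mathfrak X$ is pseudocyclic, then $\mathfrak X$ is isomorphic to the cyclotomic scheme $\mathrm{Cyc}(13,4)$. -/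

import Mathlib

/-- A `d`-class association scheme on a finite set `X`, with relations `R 0, …, R d`.
The functions `star` and `p` carry no extra information: as every relation is nonempty, they are
determined by `R`. -/
structure AssociationScheme (X : Type*) [Fintype X] (d : ℕ) where
  /-- the relations `R_i` -/
  R : Fin (d + 1) → X → X → Prop
  /-- the index `i*` of the transpose of `R_i` -/
  star : Fin (d + 1) → Fin (d + 1)
  /-- the intersection numbers: `p i j l` is `p_{i,j}^l` -/
  p : Fin (d + 1) → Fin (d + 1) → Fin (d + 1) → ℕ
  /-- every relation is nonempty -/
  nonempty : ∀ i, ∃ x y, R i x y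
  /-- `R_0` is the diagonal -/
  diag : ∀ x y, R 0 x y ↔ x = y
  /-- the relations partition `X × X` -/
  partition : ∀ x y, ∃! i, R i x y
  /-- the transpose of `R_i` is `R_{i*}` -/
  transpose : ∀ i x y, R (star i) x y ↔ R i y x
  /-- if `(x, y) ∈ R_l`, then `p_{i,j}^l` elements `z` satisfy `(x, z) ∈ R_i` and `(z, y) ∈ R_j`
  (the second condition says `z ∈ R_{j*}(y)`) -/
  inter : ∀ i j l x y, R l x y → Set.ncard {z | R i x z ∧ R j z y} = p i j l

namespace AssociationScheme

section

variable {X : Type*} [Fintype X] {d : ℕ} (S : AssociationScheme X d)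

/-- `p_{i,j}^l = p_{j,i}^l` for all `i, j, l`. -/
def IsCommutative : Prop := ∀ i j l, S.p i j l = S.p j i l

/-- The valency `k_i = p_{i,i*}^0`. -/
def valency (i : Fin (d + 1)) : ℕ := S.p i (S.star i) 0

/-- The relation `R_i` is symmetric. -/
def IsSymmRel (i : Fin (d + 1)) : Prop := i = S.star i

/-- The product `EF = {R_l | ∑_{R_i ∈ E} ∑_{R_j ∈ F} p_{i,j}^l ≠ 0}` of two sets of relations;
sets of relations are given by their sets of indices. -/
def relMul (E F : Finset (Fin (d + 1))) : Finset (Fin (d + 1)) :=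
  Finset.univ.filter fun l => ∑ i ∈ E, ∑ j ∈ F, S.p i j l ≠ 0

/-- A set `F` of relations is closed if `R_{i*} R_j ⊆ F` for all `R_i, R_j ∈ F`. -/
def IsClosedSubset (F : Finset (Fin (d + 1))) : Prop :=
  ∀ i ∈ F, ∀ j ∈ F, S.relMul {S.star i} {j} ⊆ F

/-- `R_j` generates the scheme: the only closed set of relations containing `R_j` is the set of
all relations. -/
def Generates (j : Fin (d + 1)) : Prop :=
  ∀ F : Finset (Fin (d + 1)), S.IsClosedSubset F → j ∈ F → F = Finset.univ

open Classical in
/-- The adjacency matrix of `R_i`, over the complex numbers. -/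
noncomputable def adjMat (i : Fin (d + 1)) : Matrix X X ℂ :=
  Matrix.of fun x y => if S.R i x y then 1 else 0

/-- The Bose–Mesner algebra: the complex algebra generated by the adjacency matrices. -/
noncomputable def boseMesner [DecidableEq X] : Subalgebra ℂ (Matrix X X ℂ) :=
  Algebra.adjoin ℂ (Set.range S.adjMat)

/-- `E` is a primitive idempotent of the Bose–Mesner algebra: a nonzero idempotent such that the
only idempotents of the algebra lying below it are `0` and `E`. -/
def IsPrimitiveIdempotent [DecidableEq X] (E : Matrix X X ℂ) : Prop :=
  E ∈ S.boseMesner ∧ E ≠ 0 ∧ E * E = E ∧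
    ∀ F ∈ S.boseMesner, F * F = F → F * E = F → E * F = F → F = 0 ∨ F = E

/-- The trivial idempotent `E_0 = J / n`, where `n = |X|` and `J` is the all-one matrix. -/
noncomputable def trivialIdempotent (X : Type*) [Fintype X] : Matrix X X ℂ :=
  Matrix.of fun _ _ => 1 / (Fintype.card X : ℂ)

/-- A commutative scheme is pseudocyclic if its nontrivial multiplicities (the ranks of the
primitive idempotents other than `E_0 = J / n`) all coincide. -/
def IsPseudocyclic [DecidableEq X] : Prop :=
  S.IsCommutative ∧ ∀ E F : Matrix X X ℂ, S.IsPrimitiveIdempotent E → S.IsPrimitiveIdempotent F →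
    E ≠ trivialIdempotent X → F ≠ trivialIdempotent X → E.rank = F.rank

/-- Isomorphism of schemes: a bijection of the point sets that maps the relations of the first
scheme to the relations of the second one, in some order. -/
def IsIsomorphic {Y : Type*} [Fintype Y] {e : ℕ} (T : AssociationScheme Y e) : Prop :=
  ∃ (f : X ≃ Y) (σ : Fin (d + 1) ≃ Fin (e + 1)),
    ∀ i x y, S.R i x y ↔ T.R (σ i) (f x) (f y)

end

end AssociationScheme

section Cyclotomic

variable {F : Type*} [Field F]

/-- The cyclotomic relations: `R_0` is the diagonal, and for `1 ≤ i ≤ d` we have `(x, y) ∈ R_i`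
when `x - y ∈ α ^ i ⟨α ^ d⟩`. -/
def cyclotomicRel (α : Fˣ) (d : ℕ) (i : Fin (d + 1)) (x y : F) : Prop :=
  if i = 0 then x = y
  else ∃ u ∈ Subgroup.zpowers (α ^ d), x - y = ((α ^ (i : ℕ) * u : Fˣ) : F)

theorem cyclotomic_existsUnique [Fintype F] {α : Fˣ} (hα : ∀ u : Fˣ, u ∈ Subgroup.zpowers α)
    {d : ℕ} (hd : d ∣ Fintype.card F - 1) (v : Fˣ) :
    ∃! i : Fin (d + 1), i ≠ 0 ∧ ∃ u ∈ Subgroup.zpowers (α ^ d), v = α ^ (i : ℕ) * u := by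
  have hq : 0 < Fintype.card F - 1 := by
    have := Fintype.one_lt_card (α := F)
    omega
  have hd0 : 0 < d := Nat.pos_of_dvd_of_pos hd hq
  have hord : orderOf α = Fintype.card F - 1 := by
    classical
    rw [orderOf_eq_card_of_forall_mem_zpowers hα, Nat.card_eq_fintype_card, Fintype.card_units]
  obtain ⟨n, rfl⟩ := Subgroup.mem_zpowers_iff.1 (hα v)
  have hdz : (0 : ℤ) < d := by exact_mod_cast hd0
  have h0 := Int.emod_nonneg (n - 1) hdz.ne'
  have h1 := Int.emod_lt_of_pos (n - 1) hdz
  have h2 := Int.emod_add_mul_ediv (n - 1) d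
  refine ⟨⟨((n - 1) % d).toNat + 1, by omega⟩, ⟨?_, ?_⟩, ?_⟩
  · intro h
    have := congrArg Fin.val h
    simp at this
  · refine ⟨(α ^ d) ^ ((n - 1) / d), Subgroup.zpow_mem_zpowers _ _, ?_⟩
    rw [← zpow_natCast α d, ← zpow_mul, ← zpow_natCast, ← zpow_add]
    congr 1
    push_cast
    rw [Int.toNat_of_nonneg h0]
    linarith
  · rintro i ⟨hi, u, hu, h⟩
    obtain ⟨m, rfl⟩ := Subgroup.mem_zpowers_iff.1 hu
    rw [← zpow_natCast α d, ← zpow_mul, ← zpow_natCast, ← zpow_add] at h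
    have h3 := (zpow_eq_zpow_iff_modEq.1 h).dvd
    have h4 : (d : ℤ) ∣ (i : ℕ) + d * m - n :=
      dvd_trans (by rw [hord]; exact_mod_cast hd) h3
    have hi0 : (i : ℕ) ≠ 0 := fun h => hi (Fin.ext h)
    have hil := i.2
    have h5 : (d : ℤ) ∣ (((i : ℕ) : ℤ) - 1) - (n - 1) := by
      have h7 := dvd_sub h4 (dvd_mul_right (d : ℤ) m)
      have h8 : ((i : ℕ) : ℤ) + d * m - n - d * m = (((i : ℕ) : ℤ) - 1) - (n - 1) := by ring
      rwa [h8] at h7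
    have h6 : (((i : ℕ) : ℤ) - 1) % d = (n - 1) % d := (Int.modEq_iff_dvd.2 h5).symm
    rw [Int.emod_eq_of_lt (by omega) (by omega)] at h6
    ext
    simp only
    omega

theorem cyclotomicRel_affine (α : Fˣ) (d : ℕ) (i : Fin (d + 1)) {w : Fˣ}
    (hw : w ∈ Subgroup.zpowers (α ^ d)) (c x y : F) :
    cyclotomicRel α d i ((w : F) * x + c) ((w : F) * y + c) ↔ cyclotomicRel α d i x y := by
  unfold cyclotomicRel
  split_ifs with hi
  · simp
  · have e : (w : F) * x + c - ((w : F) * y + c) = w * (x - y) := by ring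
    rw [e]
    constructor
    · rintro ⟨u, hu, h⟩
      refine ⟨w⁻¹ * u, mul_mem (inv_mem hw) hu, ?_⟩
      have : x - y = ((w⁻¹ : Fˣ) : F) * (w * (x - y)) := by simp
      rw [this, h, ← Units.val_mul]
      congr 1
      rw [mul_left_comm]
    · rintro ⟨u, hu, h⟩
      refine ⟨w * u, mul_mem hw hu, ?_⟩
      rw [h, ← Units.val_mul, mul_left_comm]

theorem cyclotomicRel_existsUnique [Fintype F] {α : Fˣ} (hα : ∀ u : Fˣ, u ∈ Subgroup.zpowers α)
    {d : ℕ} (hd : d ∣ Fintype.card F - 1) (x y : F) : ∃! i, cyclotomicRel α d i x y := by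
  by_cases hxy : x = y
  · subst hxy
    refine ⟨0, by simp [cyclotomicRel], fun i hi => ?_⟩
    by_contra h
    simp only [cyclotomicRel, h, if_false] at hi
    obtain ⟨u, -, hu⟩ := hi
    exact (α ^ (i : ℕ) * u).ne_zero (by rw [← hu, sub_self])
  · obtain ⟨i, ⟨hi, u, hu, h⟩, huniq⟩ :=
      cyclotomic_existsUnique hα hd (Units.mk0 (x - y) (sub_ne_zero.2 hxy))
    refine ⟨i, ?_, fun j hj => ?_⟩
    · simp only [cyclotomicRel, hi, if_false]
      exact ⟨u, hu, by rw [← h]; rfl⟩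
    · by_cases hj0 : j = 0
      · simp [cyclotomicRel, hj0, hxy] at hj
      · simp only [cyclotomicRel, hj0, if_false] at hj
        obtain ⟨u', hu', h'⟩ := hj
        exact huniq j ⟨hj0, u', hu', Units.ext h'⟩

theorem cyclotomicRel_transpose [Fintype F] {α : Fˣ} (hα : ∀ u : Fˣ, u ∈ Subgroup.zpowers α)
    {d : ℕ} (hd : d ∣ Fintype.card F - 1) (i : Fin (d + 1)) :
    ∃ j, ∀ x y, cyclotomicRel α d j x y ↔ cyclotomicRel α d i y x := by
  by_cases hi : i = 0
  · exact ⟨0, fun x y => by simp [cyclotomicRel, hi, eq_comm]⟩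
  · obtain ⟨j, ⟨hj, w, hw, h⟩, -⟩ := cyclotomic_existsUnique hα hd (-α ^ (i : ℕ))
    refine ⟨j, fun x y => ?_⟩
    simp only [cyclotomicRel, hi, hj, if_false]
    have hF := congrArg (Units.val) h
    constructor
    · rintro ⟨u, hu, e⟩
      refine ⟨w⁻¹ * u, mul_mem (inv_mem hw) hu, ?_⟩
      have : (α ^ (i : ℕ) : Fˣ) * (w⁻¹ * u) = -(α ^ (j : ℕ) * u) := by
        have h' : (α ^ (i : ℕ) : Fˣ) = -(α ^ (j : ℕ) * w) := by rw [← h, neg_neg]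
        rw [h', neg_mul]
        congr 1
        rw [mul_assoc, mul_inv_cancel_left]
      rw [this, Units.val_neg, ← e, neg_sub]
    · rintro ⟨u, hu, e⟩
      refine ⟨w * u, mul_mem hw hu, ?_⟩
      rw [← mul_assoc, ← h, neg_mul, Units.val_neg, ← e, neg_sub]

theorem cyclotomicRel_inter [Fintype F] (α : Fˣ) {d : ℕ} (i j l : Fin (d + 1)) :
    ∃ c : ℕ, ∀ x y, cyclotomicRel α d l x y →
      Set.ncard {z | cyclotomicRel α d i x z ∧ cyclotomicRel α d j z y} = c := by
  have key : ∃ r : F, ∀ x y, cyclotomicRel α d l x y →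
      ∃ w ∈ Subgroup.zpowers (α ^ d), x = ((w : Fˣ) : F) * r + y := by
    by_cases hl : l = 0
    · refine ⟨0, fun x y h => ⟨1, one_mem _, ?_⟩⟩
      simp only [cyclotomicRel, hl, if_true] at h
      simp [h]
    · refine ⟨((α ^ (l : ℕ) : Fˣ) : F), fun x y h => ?_⟩
      simp only [cyclotomicRel, hl, if_false] at h
      obtain ⟨u, hu, e⟩ := h
      refine ⟨u, hu, ?_⟩
      rw [← Units.val_mul, mul_comm, ← e, sub_add_cancel]
  obtain ⟨r, hr⟩ := key
  refine ⟨Set.ncard {z | cyclotomicRel α d i r z ∧ cyclotomicRel α d j z 0}, fun x y h => ?_⟩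
  obtain ⟨w, hw, rfl⟩ := hr x y h
  have hinj : Function.Injective fun z : F => (w : F) * z + y := fun a b hab => by
    simpa using hab
  rw [← Set.ncard_image_of_injective {z | cyclotomicRel α d i r z ∧ cyclotomicRel α d j z 0} hinj]
  congr 1
  ext z
  constructor
  · rintro ⟨h1, h2⟩
    have hz : (w : F) * (((w⁻¹ : Fˣ) : F) * (z - y)) + y = z := by simp
    refine ⟨((w⁻¹ : Fˣ) : F) * (z - y), ⟨?_, ?_⟩, hz⟩
    · rw [← cyclotomicRel_affine α d i hw y, hz]
      exact h1
    · rw [← cyclotomicRel_affine α d j hw y, hz, mul_zero, zero_add]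
      exact h2
  · rintro ⟨z, ⟨h1, h2⟩, rfl⟩
    refine ⟨(cyclotomicRel_affine α d i hw y _ _).2 h1, ?_⟩
    have := (cyclotomicRel_affine α d j hw y z 0).2 h2
    rwa [mul_zero, zero_add] at this

/-- The `d`-class cyclotomic scheme `Cyc(q, d)` over the field `F` with `q` elements, where `α` is
a primitive element of `F` and `d` divides `q - 1`. -/
noncomputable def cyclotomicScheme [Fintype F] (α : Fˣ) (hα : ∀ u : Fˣ, u ∈ Subgroup.zpowers α)
    (d : ℕ) (hd : d ∣ Fintype.card F - 1) : AssociationScheme F d where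
  R := cyclotomicRel α d
  star i := (cyclotomicRel_transpose hα hd i).choose
  p i j l := (cyclotomicRel_inter α i j l).choose
  nonempty i := by
    by_cases hi : i = 0
    · exact ⟨0, 0, by simp [cyclotomicRel, hi]⟩
    · refine ⟨((α ^ (i : ℕ) : Fˣ) : F), 0, ?_⟩
      simp only [cyclotomicRel, hi, if_false]
      exact ⟨1, one_mem _, by simp⟩
  diag x y := by simp [cyclotomicRel]
  partition := cyclotomicRel_existsUnique hα hd
  transpose i := (cyclotomicRel_transpose hα hd i).choose_spec
  inter i j l := (cyclotomicRel_inter α i j l).choose_spec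

end Cyclotomic

instance fact_prime_thirteen : Fact (Nat.Prime 13) := ⟨by norm_num⟩

theorem four_dvd_card_zmod_thirteen : 4 ∣ Fintype.card (ZMod 13) - 1 := by
  rw [ZMod.card]
  norm_num

/-! Write i = 1, j = 2, let k and m be the valencies of R_i and R_j, and put a = p_{ii}^i, b =
p_{ii}^{i*}, c = p_{ii}^j, f = p_{ii*}^j, h = p_{ij}^i, g = p_{ij*}^{i*}, α = p_{ij}^j, γ =
p_{ij*}^j. Let U be the sum of p_{ij*}^l k_l over the relations l outside 0, i, i*, j, j*.

Comparing coefficients in (A_i A_i) A_{i*} = A_i (A_i A_{i*}), and eliminating with cm = gk and fm =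
hk, gives in `arith_core` the identity 2(g−h)U + (k−m)g² + 2gγm = 0. Since k ≥ m, for g > h every
summand is nonnegative, so k = m, γ = 0 and U = 0. The cases g = 0 (where f = k), g < h (impossible
when g > 0) and g = h are treated separately in `parameters`; for g = h a tournament argument
(`mul_right_right_ne_zero`) excludes α = 0 and leaves α = 1. In every surviving case the five
relations are stable under multiplication by R_i, so they are all the relations because R_i
generates, and d = 4.

If the scheme is pseudocyclic, Σ A_i A_{i*}/k_i is a combination of I and J
(`IsPseudocyclic.exists_sum_eq`), so Σ p_{ii*}^l/k_i is the same for all l ≠ 0. This excludes f = k,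
forces α = h, and leaves only k = m = 3 on 13 points (`parameters_of_isPseudocyclic`). The resulting
intersection numbers 0, 1, 2 determine the digraph around any one point completely
(`exists_labelling`), which identifies it with differences 1, 3, 9 in `ZMod 13`. -/

namespace AssociationScheme

open Matrix Finset

/-! ### Counting identities and generation -/

section Basic

variable {X : Type*} [Fintype X] {d : ℕ} (S : AssociationScheme X d)

theorem adjMat_apply_of_rel {i l : Fin (d + 1)} {x y : X} (h : S.R l x y) :
    S.adjMat i x y = if i = l then 1 else 0 := by
  simp only [adjMat, Matrix.of_apply]
  congr 1
  refine propext ⟨fun h' => (S.partition x y).unique h' h, ?_⟩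
  rintro rfl
  exact h

theorem rel_unique {i j : Fin (d + 1)} {x y : X} (hi : S.R i x y) (hj : S.R j x y) : i = j :=
  (S.partition x y).unique hi hj

theorem exists_rel (x y : X) : ∃ l, S.R l x y := (S.partition x y).exists

theorem sum_smul_adjMat_apply (q : Fin (d + 1) → ℂ) {l : Fin (d + 1)} {x y : X}
    (h : S.R l x y) : (∑ i, q i • S.adjMat i) x y = q l := by
  simp [Matrix.sum_apply, S.adjMat_apply_of_rel h]

theorem star_zero : S.star 0 = 0 := by
  obtain ⟨x, -, -⟩ := S.nonempty 0
  exact S.rel_unique ((S.transpose 0 x x).2 ((S.diag x x).2 rfl)) ((S.diag x x).2 rfl)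

theorem star_star (i : Fin (d + 1)) : S.star (S.star i) = i := by
  obtain ⟨x, y, h⟩ := S.nonempty i
  exact S.rel_unique ((S.transpose _ x y).2 ((S.transpose i y x).2 h)) h

theorem star_eq_iff {i j : Fin (d + 1)} : S.star i = j ↔ i = S.star j := by
  constructor <;> rintro rfl <;> simp [star_star]

theorem star_inj {i j : Fin (d + 1)} : S.star i = S.star j ↔ i = j := by
  rw [star_eq_iff, star_star]

theorem star_eq_zero {i : Fin (d + 1)} : S.star i = 0 ↔ i = 0 := by
  rw [star_eq_iff, star_zero]

theorem adjMat_star (i : Fin (d + 1)) : S.adjMat (S.star i) = (S.adjMat i)ᵀ := by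
  ext x y
  by_cases h : S.R i y x <;> simp [adjMat, Matrix.transpose_apply, S.transpose, h]

theorem adjMat_star' (i : Fin (d + 1)) : S.adjMat (S.star i) = (S.adjMat i)ᴴ := by
  rw [adjMat_star]
  ext x y
  simp only [adjMat, Matrix.of_apply, Matrix.transpose_apply, Matrix.conjTranspose_apply]
  split_ifs <;> simp

theorem adjMat_zero [DecidableEq X] : S.adjMat 0 = 1 := by
  ext x y
  simp only [adjMat, Matrix.of_apply, S.diag, Matrix.one_apply]

theorem adjMat_mul (i j : Fin (d + 1)) :
    S.adjMat i * S.adjMat j = ∑ l, (S.p i j l : ℂ) • S.adjMat l := by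
  classical
  ext x y
  obtain ⟨l, hl⟩ := S.exists_rel x y
  rw [S.sum_smul_adjMat_apply _ hl, ← S.inter i j l x y hl, Matrix.mul_apply,
    Set.ncard_eq_toFinset_card', Finset.card_eq_sum_ones, Nat.cast_sum]
  simp only [adjMat, Matrix.of_apply, ← ite_and, mul_ite, mul_one, mul_zero, Nat.cast_one]
  rw [← Finset.sum_filter]
  congr 1
  ext z
  simp [and_comm]

theorem ncard_rel (i : Fin (d + 1)) (x : X) : Set.ncard {z | S.R i x z} = S.valency i := by
  rw [valency, ← S.inter i (S.star i) 0 x x ((S.diag x x).2 rfl)]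
  congr 1
  ext z
  simp [S.transpose]

theorem sum_adjMat_row (i : Fin (d + 1)) (x : X) : ∑ y, S.adjMat i x y = S.valency i := by
  classical
  rw [← S.ncard_rel i x, Set.ncard_eq_toFinset_card', Finset.card_eq_sum_ones, Nat.cast_sum]
  simp only [adjMat, Matrix.of_apply, Nat.cast_one]
  rw [← Finset.sum_filter]
  congr 1
  ext z
  simp

theorem linearIndependent_adjMat {q r : Fin (d + 1) → ℂ}
    (h : ∑ i, q i • S.adjMat i = ∑ i, r i • S.adjMat i) : q = r := by
  ext l
  obtain ⟨x, y, hl⟩ := S.nonempty l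
  rw [← S.sum_smul_adjMat_apply q hl, h, S.sum_smul_adjMat_apply r hl]

theorem valency_pos (i : Fin (d + 1)) : 0 < S.valency i := by
  obtain ⟨x, y, h⟩ := S.nonempty i
  rw [← S.ncard_rel i x, Set.ncard_pos]
  exact ⟨y, h⟩

theorem p_star_zero (i : Fin (d + 1)) : S.p i (S.star i) 0 = S.valency i := rfl

theorem valency_zero : S.valency 0 = 1 := by
  obtain ⟨x, -, -⟩ := S.nonempty 0
  rw [← S.ncard_rel 0 x, Set.ncard_eq_one]
  exact ⟨x, by ext; simp [S.diag, eq_comm]⟩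

theorem p_zero_left (j l : Fin (d + 1)) : S.p 0 j l = if j = l then 1 else 0 := by
  classical
  have h : ∑ l, (S.p 0 j l : ℂ) • S.adjMat l = ∑ l, (if j = l then 1 else 0 : ℂ) • S.adjMat l := by
    rw [← adjMat_mul, adjMat_zero, one_mul]
    simp
  have := congrFun (S.linearIndependent_adjMat h) l
  split_ifs at this ⊢ <;> exact_mod_cast this

theorem card_pos (S : AssociationScheme X d) : 0 < Fintype.card X := by
  obtain ⟨x, -, -⟩ := S.nonempty 0
  exact Fintype.card_pos_iff.2 ⟨x⟩

theorem trace_adjMat_mul_transpose (q : Fin (d + 1) → ℂ) (l : Fin (d + 1)) :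
    ((∑ i, q i • S.adjMat i) * (S.adjMat l)ᵀ).trace = Fintype.card X * (q l * S.valency l) := by
  have : ∀ x, ((∑ i, q i • S.adjMat i) * (S.adjMat l)ᵀ) x x = q l * S.valency l := by
    intro x
    rw [Matrix.mul_apply, ← S.sum_adjMat_row l x, Finset.mul_sum]
    refine Finset.sum_congr rfl fun y _ => ?_
    obtain ⟨e, he⟩ := S.exists_rel x y
    rw [S.sum_smul_adjMat_apply _ he, Matrix.transpose_apply, S.adjMat_apply_of_rel he]
    split_ifs with h <;> simp [h]
  simp [Matrix.trace, Matrix.diag, this]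

/-- Both sides times |X| equal tr(A_i A_j A_lᵀ): the relations are orthogonal for the trace form,
and the trace is invariant under transposition. -/
theorem p_mul_valency (i j l : Fin (d + 1)) :
    S.p i j l * S.valency l = S.p l (S.star j) i * S.valency i := by
  have h1 := S.trace_adjMat_mul_transpose (fun e => (S.p i j e : ℂ)) l
  have h2 := S.trace_adjMat_mul_transpose (fun e => (S.p l (S.star j) e : ℂ)) i
  rw [← adjMat_mul] at h1 h2
  have h3 : (S.adjMat l * S.adjMat (S.star j) * (S.adjMat i)ᵀ).trace =
      (S.adjMat i * S.adjMat j * (S.adjMat l)ᵀ).trace := by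
    rw [← Matrix.trace_transpose]
    simp [adjMat_star, Matrix.transpose_mul, Matrix.mul_assoc]
  rw [h3, h1] at h2
  have hn : (Fintype.card X : ℂ) ≠ 0 := by exact_mod_cast S.card_pos.ne'
  exact_mod_cast mul_left_cancel₀ hn h2

theorem p_star (i j l : Fin (d + 1)) :
    S.p i j l = S.p (S.star j) (S.star i) (S.star l) := by
  obtain ⟨x, y, h⟩ := S.nonempty l
  rw [← S.inter i j l x y h,
    ← S.inter (S.star j) (S.star i) (S.star l) y x ((S.transpose l y x).2 h)]
  congr 1
  ext z
  simp [S.transpose, and_comm]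

theorem valency_star (i : Fin (d + 1)) : S.valency (S.star i) = S.valency i := by
  have h3 := S.trace_adjMat_mul_transpose (fun e => if e = i then 1 else 0) i
  have h4 := S.trace_adjMat_mul_transpose (fun e => if e = S.star i then 1 else 0) (S.star i)
  simp only [ite_smul, one_smul, zero_smul, Finset.sum_ite_eq', Finset.mem_univ, if_true,
    one_mul, adjMat_star, Matrix.transpose_transpose] at h3 h4
  rw [Matrix.trace_mul_comm, h3] at h4
  have hn : (Fintype.card X : ℂ) ≠ 0 := by exact_mod_cast S.card_pos.ne'
  exact_mod_cast (mul_left_cancel₀ hn h4).symm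

theorem p_zero_right_index (i j : Fin (d + 1)) :
    S.p i j 0 = if j = S.star i then S.valency i else 0 := by
  have h := S.p_mul_valency i j 0
  rw [S.valency_zero, p_zero_left, mul_one] at h
  simp [h, S.star_eq_iff]

theorem sum_p_mul_valency (i j : Fin (d + 1)) :
    ∑ l, S.p i j l * S.valency l = S.valency i * S.valency j := by
  obtain ⟨x, -, -⟩ := S.nonempty 0
  have h : ∑ y, (S.adjMat i * S.adjMat j) x y = S.valency i * S.valency j := by
    simp only [Matrix.mul_apply]
    rw [Finset.sum_comm]
    simp only [← Finset.mul_sum, sum_adjMat_row, ← Finset.sum_mul]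
  rw [adjMat_mul] at h
  simp only [Matrix.sum_apply, Matrix.smul_apply, smul_eq_mul] at h
  rw [Finset.sum_comm] at h
  simp only [← Finset.mul_sum, sum_adjMat_row] at h
  exact_mod_cast h

theorem sum_valency : ∑ i, S.valency i = Fintype.card X := by
  obtain ⟨x, -, -⟩ := S.nonempty 0
  have : ∑ i, ∑ y, S.adjMat i x y = Fintype.card X := by
    rw [Finset.sum_comm]
    have : ∀ y, ∑ i, S.adjMat i x y = 1 := by
      intro y
      obtain ⟨l, hl⟩ := S.exists_rel x y
      simp [S.adjMat_apply_of_rel hl]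
    simp [this]
  simp only [sum_adjMat_row] at this
  exact_mod_cast this

theorem p_assoc (i j l m : Fin (d + 1)) :
    ∑ e, S.p i j e * S.p e l m = ∑ e, S.p j l e * S.p i e m := by
  have h := Matrix.mul_assoc (S.adjMat i) (S.adjMat j) (S.adjMat l)
  rw [adjMat_mul, adjMat_mul, Matrix.sum_mul, Matrix.mul_sum] at h
  simp only [Matrix.smul_mul, Matrix.mul_smul, adjMat_mul, Finset.smul_sum, smul_smul] at h
  rw [Finset.sum_comm, Finset.sum_comm (s := Finset.univ) (t := Finset.univ)
    (f := fun e m => (S.p j l e * S.p i e m : ℂ) • S.adjMat m)] at h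
  simp only [← Finset.sum_smul] at h
  have := congrFun (S.linearIndependent_adjMat h) m
  exact_mod_cast this

theorem p_pos_of_rel {i j l : Fin (d + 1)} {x y z : X} (hl : S.R l x y) (hi : S.R i x z)
    (hj : S.R j z y) : S.p i j l ≠ 0 := by
  rw [← S.inter i j l x y hl]
  exact (Set.ncard_pos (s := {z | S.R i x z ∧ S.R j z y}) |>.2 ⟨z, hi, hj⟩).ne'

theorem exists_of_p_ne_zero {i j l : Fin (d + 1)} (h : S.p i j l ≠ 0) {x y : X}
    (hl : S.R l x y) : ∃ z, S.R i x z ∧ S.R j z y := by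
  rw [← S.inter i j l x y hl] at h
  exact Set.nonempty_of_ncard_ne_zero h

/-- A nonempty set of relations, closed under transposition and under multiplication by a
generating relation, consists of all relations. -/
theorem eq_univ_of_generates_of_mul_subset (hcomm : S.IsCommutative) {g : Fin (d + 1)}
    (hgen : S.Generates g) {F : Finset (Fin (d + 1))} (h0 : 0 ∈ F)
    (hstar : ∀ i ∈ F, S.star i ∈ F) (hmul : ∀ i ∈ F, ∀ l, S.p g i l ≠ 0 → l ∈ F) :
    F = Finset.univ := by
  classical
  -- The relations whose product with F stays in F. This set is closed and contains g, hence is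
  -- everything; applied to 0 ∈ F it gives F = univ.
  let W : Finset (Fin (d + 1)) :=
    Finset.univ.filter fun e => ∀ i ∈ F, ∀ l, S.p e i l ≠ 0 → l ∈ F
  have hW : W = Finset.univ := by
    refine hgen W ?_ (by simpa [W] using hmul)
    intro i hi j hj l hl
    simp only [W, Finset.mem_filter, Finset.mem_univ, true_and, relMul,
      Finset.sum_singleton] at hi hj hl ⊢
    intro e he m hm
    obtain ⟨x, y, hxy⟩ := S.nonempty m
    obtain ⟨z, h1, h2⟩ := S.exists_of_p_ne_zero hm hxy
    obtain ⟨w, h3, h4⟩ := S.exists_of_p_ne_zero hl h1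
    obtain ⟨e', he'⟩ := S.exists_rel w y
    have h5 : e' ∈ F := hj e he e' (S.p_pos_of_rel he' h4 h2)
    -- The left factor here is i*, while only i is known to preserve F. Transposing and commuting
    -- the factors turns this into a product of i with an element of F.
    have h6 := S.p_pos_of_rel hxy h3 he'
    rw [S.p_star, star_star, hcomm] at h6
    have := hstar _ (hi _ (hstar _ h5) _ h6)
    rwa [star_star] at this
  refine Finset.eq_univ_of_forall fun i => ?_
  have hi : i ∈ W := by simp [hW]
  simp only [W, Finset.mem_filter, Finset.mem_univ, true_and] at hi
  refine hi 0 h0 i ?_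
  rw [hcomm, p_zero_left]
  simp

/-- If the out-neighbourhoods of a non-symmetric relation carry tournaments and there are no
directed triangles, then the relation has valency at most one. -/
theorem valency_le_one_of_tournament {i : Fin (d + 1)}
    (hsupp : ∀ l, S.p (S.star i) i l ≠ 0 → l = 0 ∨ l = i ∨ l = S.star i)
    (hcyc : S.p i i (S.star i) = 0) (hi : i ≠ S.star i) : S.valency i ≤ 1 := by
  obtain ⟨x, -, -⟩ := S.nonempty 0
  have htri : ∀ {y z w}, S.R i y z → S.R i z w → ¬ S.R i w y := fun h1 h2 h3 =>
    S.p_pos_of_rel ((S.transpose i _ _).2 h3) h1 h2 hcyc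
  have hirr : ∀ {y}, ¬ S.R i y y := fun h => by
    have h0 : i = 0 := S.rel_unique h ((S.diag _ _).2 rfl)
    exact hi (by rw [h0, S.star_zero])
  have hanti : ∀ {y z}, S.R i y z → ¬ S.R i z y := fun h1 h2 =>
    hi (S.rel_unique h1 ((S.transpose i _ _).2 h2))
  have htour : ∀ {y z}, S.R i x y → S.R i x z → y ≠ z → S.R i y z ∨ S.R i z y := by
    intro y z hy hz hne
    obtain ⟨l, hl⟩ := S.exists_rel y z
    rcases hsupp l (S.p_pos_of_rel hl ((S.transpose i _ _).2 hy) hz) with rfl | rfl | rfl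
    · exact absurd ((S.diag _ _).1 hl) hne
    · exact Or.inl hl
    · exact Or.inr ((S.transpose i _ _).1 hl)
  have hout : ∀ {y}, S.R i x y →
      Set.ncard {z | S.R i x z ∧ S.R (S.star i) z y} = S.p i (S.star i) i := fun h =>
    S.inter i (S.star i) i x _ h
  have hno : ∀ {y z}, S.R i x y → S.R i x z → ¬ S.R i y z := by
    intro y z hy hz hyz
    -- Without directed triangles the tournament on R_i(x) is transitive, so an arc y → z makes the
    -- out-set of z a proper subset of that of y. But this tournament is regular by `hout`.
    have hlt : Set.ncard {w | S.R i x w ∧ S.R (S.star i) w z} <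
        Set.ncard {w | S.R i x w ∧ S.R (S.star i) w y} := by
      refine Set.ncard_lt_ncard (Set.ssubset_iff_of_subset ?_ |>.2
        ⟨z, ⟨hz, (S.transpose i _ _).2 hyz⟩, fun h => hirr ((S.transpose i _ _).1 h.2)⟩)
      rintro w ⟨hw, hzw⟩
      have hzw' := (S.transpose i _ _).1 hzw
      refine ⟨hw, (S.transpose i _ _).2 ?_⟩
      have hne : y ≠ w := by
        rintro rfl
        exact hanti hyz hzw'
      exact (htour hy hw hne).resolve_right (htri hyz hzw')
    rw [hout hz, hout hy] at hlt
    exact lt_irrefl _ hlt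
  rw [← S.ncard_rel i x, Set.ncard_le_one]
  intro y hy z hz
  by_contra hne
  rcases htour hy hz hne with h | h
  · exact hno hy hz h
  · exact hno hz hy h

end Basic

end AssociationScheme

namespace AssociationScheme

open Finset

/-! ### Intersection numbers of a pair of relations -/

section Parameters

set_option linter.unusedSectionVars false

variable {X : Type*} [Fintype X] {d : ℕ} (S : AssociationScheme X d)

theorem p_star_comm (hcomm : S.IsCommutative) (i j l : Fin (d + 1)) :
    S.p i j l = S.p (S.star i) (S.star j) (S.star l) := by
  rw [S.p_star, hcomm]

theorem p_self_star (i l : Fin (d + 1)) :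
    S.p i (S.star i) l = S.p i (S.star i) (S.star l) := by
  rw [S.p_star, star_star]

theorem star_ne_zero_of_ne {i : Fin (d + 1)} (hi : i ≠ S.star i) : i ≠ 0 := by
  rintro rfl
  exact hi S.star_zero.symm

/-- The identity relation together with two relations and their transposes. -/
def pairClosure (i j : Fin (d + 1)) : Finset (Fin (d + 1)) := {0, i, S.star i, j, S.star j}

theorem mem_pairClosure {i j l : Fin (d + 1)} :
    l ∈ S.pairClosure i j ↔ l = 0 ∨ l = i ∨ l = S.star i ∨ l = j ∨ l = S.star j := by
  simp [pairClosure]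

theorem star_mem_pairClosure {i j l : Fin (d + 1)} :
    S.star l ∈ S.pairClosure i j ↔ l ∈ S.pairClosure i j := by
  simp only [mem_pairClosure, S.star_eq_zero, S.star_eq_iff, star_star]
  tauto

/-- Two non-symmetric relations that are neither equal nor transposes of each other. -/
structure IndependentPair (i j : Fin (d + 1)) : Prop where
  left : i ≠ S.star i
  right : j ≠ S.star j
  ne : j ≠ i
  ne_star : j ≠ S.star i

theorem sum_pairClosure {M : Type*} [AddCommMonoid M] {i j : Fin (d + 1)}
    (h : S.IndependentPair i j) (φ : Fin (d + 1) → M) :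
    ∑ l ∈ S.pairClosure i j, φ l = φ 0 + (φ i + (φ (S.star i) + (φ j + φ (S.star j)))) := by
  have h1 := S.star_ne_zero_of_ne h.left
  have h2 := S.star_ne_zero_of_ne h.right
  have h3 : S.star i ≠ 0 := fun e => h1 (S.star_eq_zero.1 e)
  have h4 : S.star j ≠ 0 := fun e => h2 (S.star_eq_zero.1 e)
  have h5 : i ≠ S.star j := fun e => h.ne_star (by rw [e, star_star])
  have h6 : S.star i ≠ S.star j := fun e => h.ne (S.star_inj.1 e).symm
  rw [pairClosure, Finset.sum_insert, Finset.sum_insert, Finset.sum_insert, Finset.sum_pair h.right]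
  · simp [h.ne_star.symm, h6]
  · simp [h.left, h.ne.symm, h5]
  · simp [h1.symm, h2.symm, h3.symm, h4.symm]

theorem card_pairClosure {i j : Fin (d + 1)} (h : S.IndependentPair i j) :
    (S.pairClosure i j).card = 5 := by
  rw [Finset.card_eq_sum_ones, S.sum_pairClosure h]
  norm_num

theorem sum_mul_eq_of_support {i j : Fin (d + 1)} (h : S.IndependentPair i j)
    {φ : Fin (d + 1) → ℕ} (hφ : ∀ l, φ l ≠ 0 → l ∈ S.pairClosure i j) (ψ : Fin (d + 1) → ℕ) :
    ∑ l, φ l * ψ l = φ 0 * ψ 0 + (φ i * ψ i + (φ (S.star i) * ψ (S.star i) +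
      (φ j * ψ j + φ (S.star j) * ψ (S.star j)))) := by
  rw [← S.sum_pairClosure h fun l => φ l * ψ l]
  refine (Finset.sum_subset (Finset.subset_univ _) fun l _ hl => ?_).symm
  rw [not_imp_comm.1 (hφ l) hl, zero_mul]

/-- The hypotheses on the products `R_i R_i` and `R_i R_{i*}` that make the pair `R_i, R_j`
determine multiplication by `R_i`. -/
structure QuadraticPair (i j : Fin (d + 1)) : Prop extends S.IndependentPair i j where
  comm : S.IsCommutative
  sq : ∀ l, S.p i i l ≠ 0 → l = i ∨ l = S.star i ∨ l = j
  mul_star : ∀ l, S.p i (S.star i) l ≠ 0 → l ∈ S.pairClosure i j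

namespace QuadraticPair

variable {S} {i j : Fin (d + 1)} (H : S.QuadraticPair i j)
include H

theorem ne_star' : i ≠ S.star j := fun e => H.ne_star (by rw [e, star_star])

theorem star_ne_star : S.star i ≠ S.star j := fun e => H.ne (S.star_inj.1 e).symm

theorem sq_zero : S.p i i 0 = 0 := by
  rw [p_zero_right_index, if_neg H.left]

theorem sq_star_right : S.p i i (S.star j) = 0 := by
  by_contra h
  rcases H.sq _ h with e | e | e
  · exact H.ne_star' e.symm
  · exact H.star_ne_star e.symm
  · exact H.right e.symm

theorem sq_support (l : Fin (d + 1)) (h : S.p i i l ≠ 0) : l ∈ S.pairClosure i j := by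
  rcases H.sq l h with rfl | rfl | rfl <;> simp [mem_pairClosure]

theorem mul_star_left : S.p i (S.star i) i = S.p i i i := by
  have := S.p_mul_valency i (S.star i) i
  rw [star_star] at this
  exact Nat.eq_of_mul_eq_mul_right (S.valency_pos i) this

theorem mul_star_star_left : S.p i (S.star i) (S.star i) = S.p i i i := by
  rw [← p_self_star, H.mul_star_left]

theorem mul_star_star_right : S.p i (S.star i) (S.star j) = S.p i (S.star i) j :=
  (S.p_self_star i j).symm

theorem sq_right_mul : S.p i i j * S.valency j = S.p i (S.star j) (S.star i) * S.valency i := by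
  rw [S.p_mul_valency, S.p_star j, star_star]

theorem mul_star_right_mul :
    S.p i (S.star i) j * S.valency j = S.p i j i * S.valency i := by
  rw [S.p_mul_valency, star_star, H.comm]

theorem mul_right_zero : S.p i j 0 = 0 := by
  rw [p_zero_right_index, if_neg H.ne_star]

theorem mul_right_star_left : S.p i j (S.star i) = 0 := by
  have := S.p_mul_valency j i (S.star i)
  rw [S.p_star_comm H.comm (S.star i), star_star, H.sq_star_right, zero_mul, valency_star] at this
  rw [H.comm]
  exact (Nat.mul_eq_zero.1 this).resolve_right (S.valency_pos i).ne'

theorem mul_star_right_zero : S.p i (S.star j) 0 = 0 := by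
  rw [p_zero_right_index, if_neg H.star_ne_star.symm]

theorem mul_star_right_left : S.p i (S.star j) i = S.p i j i := by
  have := S.p_mul_valency (S.star j) i i
  rw [H.mul_star_star_right, valency_star, H.mul_star_right_mul] at this
  rw [H.comm]
  exact Nat.eq_of_mul_eq_mul_right (S.valency_pos i) this

theorem mul_star_right_star_right : S.p i (S.star j) (S.star j) = S.p i j j := by
  have h1 := S.p_mul_valency i (S.star j) (S.star j)
  have h2 := S.p_mul_valency i j j
  rw [star_star, valency_star, H.comm (S.star j) j, ← h2] at h1
  exact Nat.eq_of_mul_eq_mul_right (S.valency_pos j) h1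

theorem star_mul_right (l : Fin (d + 1)) :
    S.p j (S.star i) l = S.p i (S.star j) (S.star l) := by
  rw [S.p_star, star_star]

/-- Coefficient of A_m in (A_i A_i) A_{i*} = A_i (A_i A_{i*}). The cases m = i, j, j* and m outside
the five relations are the working equations below. -/
theorem assoc (m : Fin (d + 1)) :
    S.p i i i * S.p i (S.star i) m + S.p i i (S.star i) * S.p i i (S.star m) +
      S.p i i j * S.p i (S.star j) (S.star m) =
    (if i = m then S.valency i else 0) + S.p i i i * S.p i i m + S.p i i i * S.p i (S.star i) m +
      S.p i (S.star i) j * S.p i j m + S.p i (S.star i) j * S.p i (S.star j) m := by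
  have h := S.p_assoc i i (S.star i) m
  rw [S.sum_mul_eq_of_support H.toIndependentPair H.sq_support,
    S.sum_mul_eq_of_support H.toIndependentPair H.mul_star, H.sq_zero, H.sq_star_right,
    H.mul_star_left, H.mul_star_star_left, H.mul_star_star_right, H.star_mul_right,
    S.p_star_comm H.comm (S.star i) (S.star i), star_star, H.comm i 0, p_zero_left,
    p_zero_left, p_star_zero] at h
  have e : S.valency i * (if i = m then 1 else 0) = if i = m then S.valency i else 0 := by
    split_ifs <;> simp
  rw [e] at h
  linarith

theorem valency_eq : S.valency i = S.p i i i + S.p i i (S.star i) + S.p i (S.star j) (S.star i) := by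
  have h := S.sum_p_mul_valency i i
  rw [S.sum_mul_eq_of_support H.toIndependentPair H.sq_support, H.sq_zero, H.sq_star_right,
    H.sq_right_mul, valency_star] at h
  apply Nat.eq_of_mul_eq_mul_right (S.valency_pos i)
  linarith

theorem valency_eq' : S.valency i = 1 + 2 * S.p i i i + 2 * S.p i j i := by
  have h := S.sum_p_mul_valency i (S.star i)
  rw [S.sum_mul_eq_of_support H.toIndependentPair H.mul_star, p_star_zero,
    H.mul_star_left, H.mul_star_star_left, H.mul_star_star_right, valency_star, valency_star,
    H.mul_star_right_mul, S.valency_zero] at h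
  apply Nat.eq_of_mul_eq_mul_right (S.valency_pos i)
  linarith

theorem assoc_left : S.p i i (S.star i) ^ 2 + S.p i i j * S.p i (S.star j) (S.star i) =
    S.valency i + S.p i i i ^ 2 + 2 * (S.p i (S.star i) j * S.p i j i) := by
  have h := H.assoc i
  rw [if_pos rfl, H.mul_star_left, H.mul_star_right_left] at h
  linarith

theorem assoc_right : S.p i i j * S.p i j j =
    S.p i i i * S.p i i j + S.p i (S.star i) j * (S.p i j j + S.p i (S.star j) j) := by
  have h := H.assoc j
  rw [if_neg H.ne.symm, H.sq_star_right, H.mul_star_right_star_right] at h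
  linarith

theorem assoc_star_right : S.p i i j * (S.p i i (S.star i) + S.p i (S.star j) j) =
    S.p i (S.star i) j * (S.p i j j + S.p i j (S.star j)) := by
  have h := H.assoc (S.star j)
  rw [if_neg H.ne_star', H.sq_star_right, star_star, H.mul_star_right_star_right] at h
  linarith

theorem assoc_extra {l : Fin (d + 1)} (hl : l ∉ S.pairClosure i j) :
    S.p i i j * S.p i (S.star j) (S.star l) =
      S.p i (S.star i) j * (S.p i j l + S.p i (S.star j) l) := by
  have h := H.assoc l
  have hl' : S.star l ∉ S.pairClosure i j := fun h => hl (S.star_mem_pairClosure.1 h)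
  rw [not_imp_comm.1 (H.mul_star l) hl, not_imp_comm.1 (H.sq_support l) hl,
    not_imp_comm.1 (H.sq_support _) hl', if_neg] at h
  · linarith
  · rintro rfl
    exact hl (by simp [mem_pairClosure])

/-- The number of paths through relations outside `pairClosure`. -/
theorem sum_extra : (∑ l ∈ univ \ S.pairClosure i j, S.p i (S.star j) l * S.valency l) +
    (S.p i j i + S.p i (S.star j) (S.star i)) * S.valency i +
    (S.p i (S.star j) j + S.p i j j) * S.valency j = S.valency i * S.valency j := by
  have h := S.sum_p_mul_valency i (S.star j)
  rw [← Finset.sum_sdiff (Finset.subset_univ (S.pairClosure i j)),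
    S.sum_pairClosure H.toIndependentPair, H.mul_star_right_zero, H.mul_star_right_left,
    H.mul_star_right_star_right, valency_star, valency_star] at h
  linarith

/-- The products of R_i with R_0, R_i and R_{i*} stay inside by hypothesis, so only those with R_j
and R_{j*} have to be controlled. -/
theorem pairClosure_eq_univ (hgen : S.Generates i)
    (h1 : ∀ l, l ∉ S.pairClosure i j → S.p i j l = 0)
    (h2 : ∀ l, l ∉ S.pairClosure i j → S.p i (S.star j) l = 0) :
    S.pairClosure i j = univ := by
  refine S.eq_univ_of_generates_of_mul_subset H.comm hgen (by simp [mem_pairClosure])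
    (fun l hl => S.star_mem_pairClosure.2 hl) ?_
  intro e he l hl
  rcases S.mem_pairClosure.1 he with rfl | rfl | rfl | rfl | rfl
  · rw [H.comm, p_zero_left] at hl
    simp only [ne_eq, ite_eq_right_iff, one_ne_zero, imp_false, not_not] at hl
    simp [mem_pairClosure, ← hl]
  · exact H.sq_support l hl
  · exact H.mul_star l hl
  · exact not_imp_comm.1 (h1 l) hl
  · exact not_imp_comm.1 (h2 l) hl

end QuadraticPair

end Parameters

end AssociationScheme

namespace AssociationScheme

open Finset

/-! ### Classification of the parameters -/

namespace QuadraticPair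

set_option linter.unusedSectionVars false

variable {X : Type*} [Fintype X] {d : ℕ} {S : AssociationScheme X d} {i j : Fin (d + 1)}
  (H : S.QuadraticPair i j)
include H

/-- With c = f = 0 the set {0, i, i*} is stable under multiplication by R_i, so it would be
everything, although it misses j. -/
theorem pairClosure_ne_of_stable (hgen : S.Generates i) (hc : S.p i i j = 0)
    (hf : S.p i (S.star i) j = 0) : False := by
  have hF : ({0, i, S.star i} : Finset (Fin (d + 1))) = univ := by
    refine S.eq_univ_of_generates_of_mul_subset H.comm hgen (by simp) ?_ ?_
    · intro l hl
      simp only [mem_insert, mem_singleton, S.star_eq_zero, S.star_inj, S.star_eq_iff] at hl ⊢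
      tauto
    · intro e he l hl
      simp only [mem_insert, mem_singleton] at he ⊢
      rcases he with rfl | rfl | rfl
      · rw [H.comm, p_zero_left] at hl
        simp only [ne_eq, ite_eq_right_iff, one_ne_zero, imp_false, not_not] at hl
        exact Or.inr (Or.inl hl.symm)
      · rcases H.sq l hl with h | h | h
        · exact Or.inr (Or.inl h)
        · exact Or.inr (Or.inr h)
        · exact absurd (h ▸ hc) hl
      · rcases S.mem_pairClosure.1 (H.mul_star l hl) with h | h | h | h | h
        · exact Or.inl h
        · exact Or.inr (Or.inl h)
        · exact Or.inr (Or.inr h)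
        · exact absurd (h ▸ hf) hl
        · rw [h, H.mul_star_star_right] at hl
          exact absurd hf hl
  have hj : j ∈ ({0, i, S.star i} : Finset (Fin (d + 1))) := by simp [hF]
  simp only [mem_insert, mem_singleton] at hj
  rcases hj with h | h | h
  · exact S.star_ne_zero_of_ne H.right h
  · exact H.ne h
  · exact H.ne_star h

/-- If h = 0 then f = 0. For b = 0 the out-neighbourhoods of R_i are tournaments without directed
triangles in R_i, forcing k ≤ 1; for b ≠ 0 the coefficient of A_{j*} gives c = 0, so R_j is never
reached. -/
theorem p_mul_left_pos (hgen : S.Generates i) (hk₁ : 1 < S.valency i) : 0 < S.p i j i := by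
  by_contra h0
  have h0 : S.p i j i = 0 := by omega
  have hf : S.p i (S.star i) j = 0 := by
    have := H.mul_star_right_mul
    rw [h0, zero_mul] at this
    exact (Nat.mul_eq_zero.1 this).resolve_right (S.valency_pos j).ne'
  by_cases hb : S.p i i (S.star i) = 0
  · refine absurd (S.valency_le_one_of_tournament (i := i) (fun l hl => ?_) hb H.left) (by omega)
    rw [H.comm] at hl
    rcases S.mem_pairClosure.1 (H.mul_star l hl) with h | h | h | h | h
    · exact Or.inl h
    · exact Or.inr (Or.inl h)
    · exact Or.inr (Or.inr h)
    · exact absurd (h ▸ hf) hl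
    · rw [h, H.mul_star_star_right] at hl
      exact absurd hf hl
  · have hc := H.assoc_star_right
    rw [hf, zero_mul] at hc
    exact H.pairClosure_ne_of_stable hgen ((Nat.mul_eq_zero.1 hc).resolve_right (by omega)) hf

/-- The first two identities are the coefficients of A_j and A_i in `assoc`, with c and f eliminated
through cm = gk and fm = hk. Substituting them into 2(g−h) times `sum_extra` yields the third, whose
signs drive the classification. -/
theorem arith_core :
    ((S.p i (S.star j) (S.star i) : ℤ) - S.p i j i) * S.p i j j =
      S.p i (S.star j) (S.star i) * S.p i i i + S.p i j i * S.p i (S.star j) j ∧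
    (S.valency j : ℤ) * (S.p i (S.star j) (S.star i) ^ 2 + 2 * S.p i (S.star j) (S.star i) *
      S.p i i i - 2 * (S.p i (S.star j) (S.star i) - S.p i j i) * S.valency i) =
    S.valency i * (2 * S.p i j i ^ 2 - S.p i (S.star j) (S.star i) ^ 2) ∧
    2 * ((S.p i (S.star j) (S.star i) : ℤ) - S.p i j i) *
      ((∑ l ∈ univ \ S.pairClosure i j, S.p i (S.star j) l * S.valency l : ℕ) : ℤ) +
      (S.valency i - S.valency j) * S.p i (S.star j) (S.star i) ^ 2 +
      2 * S.p i (S.star j) (S.star i) * S.p i (S.star j) j * S.valency j = 0 := by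
  have hU := H.sum_extra
  have e1 := H.valency_eq
  have e2 := H.valency_eq'
  have e3 := H.assoc_left
  have e4 := H.assoc_right
  have e6 := H.sq_right_mul
  have e7 := H.mul_star_right_mul
  have hk0 := S.valency_pos i
  generalize (∑ l ∈ univ \ S.pairClosure i j, S.p i (S.star j) l * S.valency l) = U at *
  generalize S.valency i = k at *
  generalize S.valency j = m at *
  generalize S.p i i i = a at *
  generalize S.p i i (S.star i) = b at *
  generalize S.p i i j = c at *
  generalize S.p i (S.star i) j = f at *
  generalize S.p i j i = h at *
  generalize S.p i (S.star j) (S.star i) = g at *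
  generalize S.p i (S.star j) j = γ at *
  generalize S.p i j j = α at *
  zify at *
  have hk : (k : ℤ) ≠ 0 := hk0.ne'
  have A1 : ((g : ℤ) - h) * α = g * a + h * γ := by
    apply mul_left_cancel₀ hk
    linear_combination m * e4 - (α - a) * e6 + (α + γ) * e7
  have A2 : (m : ℤ) * (g ^ 2 + 2 * g * a - 2 * (g - h) * k) = k * (2 * h ^ 2 - g ^ 2) := by
    have hb : (b : ℤ) = 1 + a + 2 * h - g := by linarith
    have hk' : (k : ℤ) = 1 + 2 * a + 2 * h := by linarith
    rw [hb] at e3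
    have e3' : (1 + a + 2 * h - g : ℤ) ^ 2 * m + g * k * g = (k + a ^ 2) * m + 2 * (h * k * h) := by
      linear_combination m * e3 - g * e6 + 2 * h * e7
    rw [hk'] at e3' ⊢
    linear_combination e3'
  refine ⟨A1, A2, ?_⟩
  linear_combination 2 * (g - h) * hU - 2 * m * A1 - A2

/-- If α = 0, all products with R_j become explicit enough to see that out-neighbourhoods of R_j are
tournaments without directed triangles. This forces m ≤ 1, against m = k = 1 + 2h. -/
theorem mul_right_right_ne_zero (hh : 0 < S.p i j i) (e : S.valency j = S.valency i)
    (ha : S.p i i i = 0) (hγ : S.p i (S.star j) j = 0)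
    (hs : S.p i (S.star j) (S.star i) = S.p i j i) : S.p i j j ≠ 0 := by
  intro hα0
  have hm0 := S.valency_pos j
  have hk0 := S.valency_pos i
  have e2 := H.valency_eq'
  have e1 := H.valency_eq
  have extra : ∀ l, l ∉ S.pairClosure i j → S.star l ∉ S.pairClosure i j := fun l hl h =>
    hl (S.star_mem_pairClosure.1 h)
  have hcf : S.p i i j = S.p i j i ∧ S.p i (S.star i) j = S.p i j i := by
    have h1 := H.sq_right_mul
    have h2 := H.mul_star_right_mul
    rw [e] at h1 h2
    rw [hs] at h1
    exact ⟨Nat.eq_of_mul_eq_mul_right hk0 h1, Nat.eq_of_mul_eq_mul_right hk0 h2⟩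
  have hb : S.p i i (S.star i) = 1 + S.p i j i := by omega
  have hβ : S.p i j (S.star j) = 1 + S.p i j i := by
    have := H.assoc_star_right
    rw [hcf.1, hcf.2, hα0, hb, hγ] at this
    have := Nat.eq_of_mul_eq_mul_left hh this
    omega
  have hv : ∀ l, l ∉ S.pairClosure i j → S.p i j l = 0 := by
    intro l hl
    have h1 := H.assoc_extra hl
    have h2 := H.assoc_extra (extra l hl)
    rw [star_star] at h2
    rw [hcf.1, hcf.2] at h1 h2
    have := Nat.eq_of_mul_eq_mul_left hh h1
    have := Nat.eq_of_mul_eq_mul_left hh h2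
    omega
  -- Coefficients in (A_i A_i) A_j = A_i (A_i A_j), which is where p_{jj} enters.
  have key : ∀ m, (1 + S.p i j i) * S.p i (S.star j) (S.star m) + S.p i j i * S.p j j m =
      S.p i j i * S.p i i m + (1 + S.p i j i) * S.p i (S.star j) m := by
    intro m
    have h := S.p_assoc i i j m
    rw [S.sum_mul_eq_of_support H.toIndependentPair H.sq_support,
      S.sum_mul_eq_of_support H.toIndependentPair (fun l hl => not_imp_comm.1 (hv l) hl),
      H.sq_zero, H.sq_star_right, H.mul_right_zero, H.mul_right_star_left, hα0, ha, hb, hβ,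
      hcf.1, S.p_star_comm H.comm (S.star i) j, star_star] at h
    linarith
  have hjj : S.p j j j = S.p i j i := by
    have := key j
    rw [H.mul_star_right_star_right, hα0, hγ, hcf.1] at this
    apply Nat.eq_of_mul_eq_mul_left hh
    linarith
  have hjj' : S.p j j (S.star j) = 0 := by
    have := key (S.star j)
    rw [H.mul_star_right_star_right, hα0, star_star, hγ, H.sq_star_right] at this
    have : S.p i j i * S.p j j (S.star j) = 0 := by linarith
    exact (Nat.mul_eq_zero.1 this).resolve_left hh.ne'
  have hjs : S.p j (S.star j) j = S.p i j i := by
    have := S.p_mul_valency j (S.star j) j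
    rw [star_star, hjj] at this
    exact Nat.eq_of_mul_eq_mul_right hm0 this
  have hsum := S.sum_p_mul_valency j (S.star j)
  have h0j : (0 : Fin (d + 1)) ∉ ({j, S.star j} : Finset (Fin (d + 1))) := by
    have := S.star_ne_zero_of_ne H.right
    have h' : S.star j ≠ 0 := fun h => this (S.star_eq_zero.1 h)
    simp [this.symm, h'.symm]
  rw [← Finset.sum_sdiff (Finset.subset_univ {0, j, S.star j}), Finset.sum_insert h0j,
    Finset.sum_pair H.right, p_star_zero, ← p_self_star, hjs, valency_star, e,
    S.valency_zero] at hsum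
  -- R_0, R_j and R_{j*} already contribute k + 2hk = k², the entire sum.
  have hrest : ∑ l ∈ univ \ {0, j, S.star j}, S.p j (S.star j) l * S.valency l = 0 := by
    rw [ha] at e2
    nlinarith
  refine absurd (S.valency_le_one_of_tournament (i := j) (fun l hl => ?_) hjj' H.right)
    (by omega)
  by_contra hl'
  rw [H.comm] at hl
  have := Finset.sum_eq_zero_iff.1 hrest l (by simpa using hl')
  exact hl ((Nat.mul_eq_zero.1 this).resolve_right (S.valency_pos l).ne')

set_option maxHeartbeats 800000 in
/-- The parameters of a quadratic pair. -/
theorem parameters (hgen : S.Generates i) (hk₁ : 1 < S.valency i)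
    (hk : S.valency j ≤ S.valency i) :
    S.pairClosure i j = univ ∧
      (S.p i (S.star i) j = S.valency i ∨
        S.valency j = S.valency i ∧ S.p i (S.star j) j = 0 ∧
        (S.p i i i = 0 ∧ S.p i (S.star j) (S.star i) = S.p i j i ∧ S.p i j j = 1 ∨
          ∃ s : ℕ, 0 < s ∧ S.p i (S.star j) (S.star i) = S.p i j i + s ∧
            s * S.p i j j = S.p i (S.star j) (S.star i) * S.p i i i ∧
            S.p i i i * S.p i j i + s * s = s * (S.p i i i + 1))) := by
  have hh := H.p_mul_left_pos hgen hk₁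
  have hm0 := S.valency_pos j
  have hk0 := S.valency_pos i
  have hf0 : 0 < S.p i (S.star i) j := by
    have := H.mul_star_right_mul
    by_contra h0
    have h0 : S.p i (S.star i) j = 0 := by omega
    rw [h0, zero_mul] at this
    have := Nat.mul_pos hh hk0
    omega
  have extra : ∀ l, l ∉ S.pairClosure i j → S.star l ∉ S.pairClosure i j := fun l hl h =>
    hl (S.star_mem_pairClosure.1 h)
  have hzero : (∀ l, l ∉ S.pairClosure i j → S.p i (S.star j) l = 0) →
      S.pairClosure i j = univ := by
    intro hu
    refine H.pairClosure_eq_univ hgen (fun l hl => ?_) hu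
    have := H.assoc_extra hl
    rw [hu _ (extra l hl), hu l hl, mul_zero, add_zero] at this
    exact (Nat.mul_eq_zero.1 this.symm).resolve_left hf0.ne'
  have hsumzero : (∑ l ∈ univ \ S.pairClosure i j, S.p i (S.star j) l * S.valency l) = 0 →
      ∀ l, l ∉ S.pairClosure i j → S.p i (S.star j) l = 0 := by
    intro h l hl
    have := Finset.sum_eq_zero_iff.1 h l (by simp [hl])
    exact (Nat.mul_eq_zero.1 this).resolve_right (S.valency_pos l).ne'
  obtain ⟨A1, A2, A3⟩ := H.arith_core
  rcases Nat.eq_zero_or_pos (S.p i (S.star j) (S.star i)) with hg | hg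
  · -- the wreath product case
    have hc : S.p i i j = 0 := by
      have := H.sq_right_mul
      rw [hg, zero_mul] at this
      exact (Nat.mul_eq_zero.1 this).resolve_right hm0.ne'
    have hall : ∀ l, l ∉ S.pairClosure i j → S.p i j l = 0 ∧ S.p i (S.star j) l = 0 := by
      intro l hl
      have := H.assoc_extra hl
      rw [hc, zero_mul] at this
      have := (Nat.mul_eq_zero.1 this.symm).resolve_left hf0.ne'
      omega
    refine ⟨H.pairClosure_eq_univ hgen (fun l hl => (hall l hl).1) fun l hl => (hall l hl).2,
      Or.inl ?_⟩
    have h1 := H.assoc_right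
    rw [hc, zero_mul, mul_zero, zero_add] at h1
    have h2 := (Nat.mul_eq_zero.1 h1.symm).resolve_left hf0.ne'
    have hU := H.sum_extra
    rw [Finset.sum_eq_zero (fun l hl => by
      rw [(hall l (by simpa using hl)).2, zero_mul]), hg] at hU
    have h3 : S.p i (S.star j) j = 0 := by omega
    have h4 : S.p i j j = 0 := by omega
    rw [h3, h4] at hU
    have h5 : S.p i j i = S.valency j := by
      apply Nat.eq_of_mul_eq_mul_right hk0
      linarith
    have h6 := H.mul_star_right_mul
    rw [h5] at h6
    apply Nat.eq_of_mul_eq_mul_right hm0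
    linarith
  · have hkm : (0 : ℤ) ≤ S.valency i - S.valency j := by
      have : (S.valency j : ℤ) ≤ S.valency i := by exact_mod_cast hk
      linarith
    have hg' : (0 : ℤ) < S.p i (S.star j) (S.star i) := by exact_mod_cast hg
    have hm' : (0 : ℤ) < S.valency j := by exact_mod_cast hm0
    have hk' : (0 : ℤ) < S.valency i := by exact_mod_cast hk0
    have hh' : (0 : ℤ) < S.p i j i := by exact_mod_cast hh
    have T1 : (0 : ℤ) ≤ (S.valency i - S.valency j) * S.p i (S.star j) (S.star i) ^ 2 := by
      positivity
    have T2 : (0 : ℤ) ≤ 2 * S.p i (S.star j) (S.star i) * S.p i (S.star j) j * S.valency j := by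
      positivity
    have concl : ((S.valency i : ℤ) - S.valency j) * S.p i (S.star j) (S.star i) ^ 2 = 0 →
        (2 * S.p i (S.star j) (S.star i) * S.p i (S.star j) j * S.valency j : ℤ) = 0 →
        S.valency j = S.valency i ∧ S.p i (S.star j) j = 0 := by
      intro t1 t2
      constructor
      · have := (mul_eq_zero.1 t1).resolve_right (by positivity)
        omega
      · have := (mul_eq_zero.1 ((mul_eq_zero.1 t2).resolve_right hm'.ne')).resolve_left
          (by positivity)
        exact_mod_cast this
    -- With m = k, the second identity divided by k becomes ah = s(a + 1 − s), where s = g − h.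
    have quad : S.valency j = S.valency i →
        (S.p i i i * S.p i j i : ℤ) = (S.p i (S.star j) (S.star i) - S.p i j i) *
          (S.p i i i + 1 - (S.p i (S.star j) (S.star i) - S.p i j i)) := by
      intro e
      rw [e] at A2
      have := mul_left_cancel₀ hk'.ne' A2
      have e2 : (S.valency i : ℤ) = 1 + 2 * S.p i i i + 2 * S.p i j i := by
        exact_mod_cast H.valency_eq'
      rw [e2] at this
      linarith
    rcases lt_trichotomy (S.p i (S.star j) (S.star i)) (S.p i j i) with hs | hs | hs
    · exfalso
      -- For g < h we have c < f, and adding `assoc_extra` for l and l* then forces p_{ij*}^l = 0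
      -- outside the five relations. So U = 0, and the remaining terms give k = m and γ = 0. Now
      -- (g−h)α = ga gives a = 0, which contradicts `quad`.
      have hfc : S.p i i j < S.p i (S.star i) j := by
        apply Nat.lt_of_mul_lt_mul_right (a := S.valency j)
        rw [H.sq_right_mul, H.mul_star_right_mul]
        exact Nat.mul_lt_mul_of_pos_right hs hk0
      have hu : ∀ l, l ∉ S.pairClosure i j → S.p i (S.star j) l = 0 := by
        intro l hl
        have h1 := H.assoc_extra hl
        have h2 := H.assoc_extra (extra l hl)
        rw [star_star] at h2
        by_contra hne
        have h3 := Nat.mul_lt_mul_of_pos_right hfc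
          (show 0 < S.p i (S.star j) l + S.p i (S.star j) (S.star l) by omega)
        have h4 := Nat.zero_le (S.p i (S.star i) j * S.p i j l)
        have h5 := Nat.zero_le (S.p i (S.star i) j * S.p i j (S.star l))
        linarith
      rw [Finset.sum_eq_zero (fun l hl => by rw [hu l (by simpa using hl), zero_mul])] at A3
      have hs' : (S.p i (S.star j) (S.star i) : ℤ) < S.p i j i := by exact_mod_cast hs
      push_cast at A3
      obtain ⟨e, hγ⟩ := concl (by linarith) (by linarith)
      have q := quad e
      rw [hγ] at A1
      have ha : (S.p i i i : ℤ) = 0 := by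
        have : (0 : ℤ) ≤ S.p i i i := by positivity
        have : (0 : ℤ) ≤ S.p i j j := by positivity
        push_cast at A1
        nlinarith
      rw [ha] at q
      nlinarith
    · rw [hs, sub_self] at A3 A1
      rw [hs] at T1 T2 concl hg'
      obtain ⟨e, hγ⟩ := concl (by linarith) (by linarith)
      have ha : S.p i i i = 0 := by
        rw [hγ] at A1
        have : (S.p i j i : ℤ) * S.p i i i = 0 := by push_cast at A1; linarith
        exact_mod_cast (mul_eq_zero.1 this).resolve_left hh'.ne'
      have e2 := H.valency_eq'
      have e1 := H.valency_eq
      have hU := H.sum_extra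
      rw [e, hγ, hs] at hU
      -- For g = h the identity no longer sees U. Instead U + (2h + α)k = k² with k = 1 + 2h bounds
      -- α, and α = 1 makes U vanish.
      have hα1 : S.p i j j ≤ 1 := by
        have h1 : (2 * S.p i j i + S.p i j j) * S.valency i ≤ S.valency i * S.valency i := by
          generalize (∑ l ∈ univ \ S.pairClosure i j, S.p i (S.star j) l * S.valency l) = U at hU
          linarith
        have h2 := Nat.le_of_mul_le_mul_right h1 hk0
        omega
      have hα : S.p i j j = 1 := by
        by_contra hne
        exact H.mul_right_right_ne_zero hh e ha hγ hs (by omega)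
      refine ⟨hzero (hsumzero ?_), Or.inr ⟨e, hγ, Or.inl ⟨ha, hs, hα⟩⟩⟩
      have hkk := congrArg (· * S.valency i) e2
      simp only [ha] at hkk
      rw [hα] at hU
      linarith
    · obtain ⟨s, hs'⟩ := Nat.exists_eq_add_of_lt hs
      have hgs : S.p i (S.star j) (S.star i) = S.p i j i + (s + 1) := by omega
      have hgs' : (S.p i (S.star j) (S.star i) : ℤ) - S.p i j i = (s + 1 : ℕ) := by
        rw [hgs]; push_cast; ring
      rw [hgs'] at A1 A3 quad
      have T3 : (0 : ℤ) ≤ 2 * ((s + 1 : ℕ) : ℤ) *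
        ((∑ l ∈ univ \ S.pairClosure i j, S.p i (S.star j) l * S.valency l : ℕ) : ℤ) := by
        positivity
      obtain ⟨e, hγ⟩ := concl (by linarith) (by linarith)
      have hU : (2 * ((s + 1 : ℕ) : ℤ) *
        ((∑ l ∈ univ \ S.pairClosure i j, S.p i (S.star j) l * S.valency l : ℕ) : ℤ)) = 0 := by
        linarith
      have hU := (mul_eq_zero.1 hU).resolve_left (by positivity)
      refine ⟨hzero (hsumzero (by exact_mod_cast hU)),
        Or.inr ⟨e, hγ, Or.inr ⟨s + 1, Nat.succ_pos s, hgs, ?_, ?_⟩⟩⟩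
      · rw [hγ, Nat.cast_zero, mul_zero, add_zero] at A1
        exact_mod_cast A1
      · have := quad e
        zify at this ⊢
        linarith

end QuadraticPair

end AssociationScheme

namespace AssociationScheme

open Matrix Finset

/-! ### Primitive idempotents and the pseudocyclic condition -/

section Pseudocyclic

open scoped IsMulCommutative ComplexOrder

/-- A reduced Artinian ring is the product of its residue fields, and each of these, being finite
over ℂ, is ℂ itself. -/
theorem exists_orthogonal_idempotents (R : Type*) [CommRing R] [Algebra ℂ R]
    [Module.Finite ℂ R] [IsReduced R] :
    ∃ (n : ℕ) (e : Fin n → R), (∀ i, e i ≠ 0 ∧ e i * e i = e i) ∧ ∑ i, e i = 1 ∧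
      ∀ r i, ∃ c : ℂ, r * e i = c • e i := by
  classical
  have : IsArtinianRing R := IsArtinianRing.of_finite ℂ R
  let f := IsArtinianRing.equivPi R
  have hfin : Finite (MaximalSpectrum R) := inferInstance
  let := Fintype.ofFinite (MaximalSpectrum R)
  let g := (Fintype.equivFin (MaximalSpectrum R)).symm
  refine ⟨_, fun i => f.symm (Pi.single (g i) 1), fun i => ⟨?_, ?_⟩, ?_, fun r i => ?_⟩
  · rw [ne_eq, EmbeddingLike.map_eq_zero_iff, Pi.single_eq_zero_iff]
    have := Ideal.Quotient.nontrivial_iff.2 (g i).isMaximal.ne_top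
    exact one_ne_zero
  · rw [← map_mul, ← Pi.single_mul, one_mul]
  · rw [← map_sum, g.sum_comp fun I => (Pi.single I 1 : ∀ I : MaximalSpectrum R, R ⧸ I.asIdeal)]
    rw [Finset.univ_sum_single (fun I : MaximalSpectrum R => (1 : R ⧸ I.asIdeal))]
    exact map_one f.symm
  · let := Ideal.Quotient.field (g i).asIdeal
    have hs : Function.Surjective (algebraMap ℂ (R ⧸ (g i).asIdeal)) :=
      (IsAlgClosed.algebraMap_bijective_of_isIntegral).2
    obtain ⟨c, hc⟩ := hs (Ideal.Quotient.mk _ r)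
    refine ⟨c, f.injective ?_⟩
    rw [Algebra.smul_def, map_mul, map_mul]
    simp only [AlgEquiv.apply_symm_apply]
    ext J
    rw [Pi.mul_apply, Pi.mul_apply]
    by_cases h : J = g i
    · subst h
      simp only [Pi.single_eq_same, mul_one]
      rw [show f r (g i) = Ideal.Quotient.mk _ r from rfl, ← hc]
      rfl
    · simp [Pi.single_eq_of_ne h]

theorem isIdempotentElem_toLin' {X : Type*} [Fintype X] [DecidableEq X] {E : Matrix X X ℂ}
    (hE : E * E = E) : IsIdempotentElem (Matrix.toLin' E) := by
  rw [IsIdempotentElem, Module.End.mul_eq_comp, ← Matrix.toLin'_mul, hE]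

theorem trace_eq_rank_of_idempotent {X : Type*} [Fintype X] [DecidableEq X] {E : Matrix X X ℂ}
    (hE : E * E = E) : E.trace = E.rank := by
  rw [← Matrix.trace_toLin'_eq, (LinearMap.IsIdempotentElem.isProj_range _ (isIdempotentElem_toLin' hE)).trace]
  rfl

variable {X : Type*} [Fintype X] [DecidableEq X] {d : ℕ} (S : AssociationScheme X d)

theorem adjMat_mem_boseMesner (i : Fin (d + 1)) : S.adjMat i ∈ S.boseMesner :=
  Algebra.subset_adjoin ⟨i, rfl⟩

theorem exists_eq_sum_of_mem_boseMesner {Y : Matrix X X ℂ} (hY : Y ∈ S.boseMesner) :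
    ∃ q : Fin (d + 1) → ℂ, Y = ∑ i, q i • S.adjMat i := by
  have hspan : ∀ Z, Z ∈ Submodule.span ℂ (Set.range S.adjMat) ↔
      ∃ q : Fin (d + 1) → ℂ, ∑ i, q i • S.adjMat i = Z :=
    fun Z => Submodule.mem_span_range_iff_exists_fun ℂ
  suffices Y ∈ Submodule.span ℂ (Set.range S.adjMat) by
    obtain ⟨q, hq⟩ := (hspan Y).1 this
    exact ⟨q, hq.symm⟩
  have hA : ∀ i, S.adjMat i ∈ Submodule.span ℂ (Set.range S.adjMat) := fun i =>
    Submodule.subset_span ⟨i, rfl⟩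
  induction hY using Algebra.adjoin_induction with
  | mem Z hZ => exact Submodule.subset_span hZ
  | algebraMap r =>
    rw [Algebra.algebraMap_eq_smul_one, ← S.adjMat_zero]
    exact Submodule.smul_mem _ _ (hA 0)
  | add Z W _ _ hZ hW => exact Submodule.add_mem _ hZ hW
  | mul Z W _ _ hZ hW =>
    obtain ⟨q, rfl⟩ := (hspan Z).1 hZ
    obtain ⟨r, rfl⟩ := (hspan W).1 hW
    simp only [Matrix.sum_mul, Matrix.mul_sum, Matrix.smul_mul, Matrix.mul_smul, adjMat_mul]
    exact Submodule.sum_mem _ fun i _ => Submodule.smul_mem _ _ (Submodule.sum_mem _ fun j _ =>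
      Submodule.smul_mem _ _ (Submodule.sum_mem _ fun l _ => Submodule.smul_mem _ _ (hA l)))

theorem conjTranspose_mem_boseMesner {Y : Matrix X X ℂ} (hY : Y ∈ S.boseMesner) :
    Yᴴ ∈ S.boseMesner := by
  obtain ⟨q, rfl⟩ := S.exists_eq_sum_of_mem_boseMesner hY
  rw [Matrix.conjTranspose_sum]
  refine Subalgebra.sum_mem _ fun i _ => ?_
  rw [Matrix.conjTranspose_smul, ← adjMat_star']
  exact Subalgebra.smul_mem _ (S.adjMat_mem_boseMesner _) _

variable {S}

theorem IsCommutative.isMulCommutative (hcomm : S.IsCommutative) :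
    IsMulCommutative S.boseMesner := by
  apply Algebra.isMulCommutative_adjoin
  rintro _ ⟨i, rfl⟩ _ ⟨j, rfl⟩
  rw [adjMat_mul, adjMat_mul]
  exact Finset.sum_congr rfl fun l _ => by rw [hcomm]

/-- The algebra is commutative and closed under conjugate transposition, hence reduced, and
therefore splits into copies of ℂ. -/
theorem IsCommutative.exists_idempotents (hcomm : S.IsCommutative) :
    ∃ (n : ℕ) (E : Fin n → Matrix X X ℂ), (∀ I, S.IsPrimitiveIdempotent (E I)) ∧ ∑ I, E I = 1 ∧
      ∀ I, ∀ Y ∈ S.boseMesner, ∃ c : ℂ, Y * E I = c • E I := by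
  have := hcomm.isMulCommutative
  have hmul : ∀ Y ∈ S.boseMesner, ∀ Z ∈ S.boseMesner, Y * Z = Z * Y := fun Y hY Z hZ =>
    congrArg Subtype.val (this.is_comm.comm (⟨Y, hY⟩ : S.boseMesner) ⟨Z, hZ⟩)
  have hred : IsReduced S.boseMesner := by
    rw [isReduced_iff_pow_one_lt 2 one_lt_two]
    rintro ⟨Y, hY⟩ h
    have h : Y * Y = 0 := by
      rw [← sq]
      exact congrArg Subtype.val h
    have hc := hmul Y hY Yᴴ (S.conjTranspose_mem_boseMesner hY)
    -- Y is normal, so Y² = 0 kills YᴴY, and then Y, by positivity.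
    have h2 : (Yᴴ * Y)ᴴ * (Yᴴ * Y) = 0 := by
      calc (Yᴴ * Y)ᴴ * (Yᴴ * Y) = Yᴴ * (Y * Yᴴ) * Y := by
            simp only [Matrix.conjTranspose_mul, Matrix.conjTranspose_conjTranspose,
              Matrix.mul_assoc]
        _ = Yᴴ * Yᴴ * (Y * Y) := by rw [hc]; simp only [Matrix.mul_assoc]
        _ = 0 := by rw [h, Matrix.mul_zero]
    exact Subtype.ext (Matrix.conjTranspose_mul_self_eq_zero.1
      (Matrix.conjTranspose_mul_self_eq_zero.1 h2))
  obtain ⟨n, e, h1, h2, h3⟩ := exists_orthogonal_idempotents S.boseMesner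
  have h3' : ∀ I, ∀ Y ∈ S.boseMesner, ∃ c : ℂ, Y * (e I : Matrix X X ℂ) = c • (e I : Matrix X X ℂ) := by
    intro I Y hY
    obtain ⟨c, hc⟩ := h3 ⟨Y, hY⟩ I
    exact ⟨c, congrArg Subtype.val hc⟩
  have hne : ∀ I, (e I : Matrix X X ℂ) ≠ 0 := fun I h => (h1 I).1 (Subtype.ext h)
  have hid : ∀ I, (e I : Matrix X X ℂ) * e I = e I := fun I => congrArg Subtype.val (h1 I).2
  refine ⟨n, fun I => e I, fun I => ⟨(e I).2, hne I, hid I, ?_⟩, ?_, h3'⟩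
  · intro F hF hFF hFE _
    obtain ⟨c, hc⟩ := h3' I F hF
    rw [hFE] at hc
    rw [hc, Matrix.smul_mul, Matrix.mul_smul, hid, smul_smul] at hFF
    have : c * c = c := smul_left_injective ℂ (hne I) hFF
    rcases eq_or_ne c 0 with h | h
    · exact Or.inl (by rw [hc, h, zero_smul])
    · rw [mul_left_cancel₀ h (this.trans (mul_one c).symm), one_smul] at hc
      exact Or.inr hc
  · have := congrArg Subtype.val h2
    simpa using this

/-- The matrix `∑ A_i A_i^T / k_i` acts on a primitive idempotent of rank `m` as `|X| / m`. -/
theorem sum_adjMat_mul_star_mul {E : Matrix X X ℂ} (hE : E ∈ S.boseMesner) (h0 : E ≠ 0)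
    (hid : E * E = E) (heig : ∀ Y ∈ S.boseMesner, ∃ c : ℂ, Y * E = c • E) :
    (∑ i, (S.valency i : ℂ)⁻¹ • (S.adjMat i * S.adjMat (S.star i))) * E =
      ((Fintype.card X : ℂ) / E.rank) • E := by
  obtain ⟨q, hq⟩ := S.exists_eq_sum_of_mem_boseMesner hE
  have hm : (E.rank : ℂ) ≠ 0 := by
    intro h
    rw [← trace_eq_rank_of_idempotent hid, ← Matrix.trace_toLin'_eq] at h
    exact h0 (Matrix.toLin'.map_eq_zero_iff.1
      (LinearMap.IsIdempotentElem.eq_zero_of_trace_eq_zero (isIdempotentElem_toLin' hid) h))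
  choose s hs using fun i => heig (S.adjMat (S.star i)) (S.adjMat_mem_boseMesner _)
  -- Compute tr(A_{i*} E) twice: from the eigenvalue it is s_i · rank E, from the expansion of E it
  -- is |X| q_i k_i.
  have hsq : ∀ i, (S.valency i : ℂ)⁻¹ * s i = (Fintype.card X : ℂ) / E.rank * q i := by
    intro i
    have h1 := congrArg Matrix.trace (hs i)
    rw [Matrix.trace_smul, trace_eq_rank_of_idempotent hid, Matrix.trace_mul_comm, adjMat_star] at h1
    nth_rewrite 1 [hq] at h1
    rw [trace_adjMat_mul_transpose] at h1
    have hk : (S.valency i : ℂ) ≠ 0 := Nat.cast_ne_zero.2 (S.valency_pos i).ne'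
    rw [smul_eq_mul] at h1
    field_simp
    linear_combination -h1
  calc _ = ∑ i, ((Fintype.card X : ℂ) / E.rank) • ((q i • S.adjMat i) * E) := by
        rw [Matrix.sum_mul]
        refine Finset.sum_congr rfl fun i _ => ?_
        rw [Matrix.smul_mul, Matrix.mul_assoc, hs, Matrix.mul_smul, smul_smul, hsq,
          Matrix.smul_mul, smul_smul]
    _ = _ := by
        rw [← Finset.smul_sum, ← Matrix.sum_mul, ← hq, hid]

/-- Equal ranks mean that M = Σ A_i A_{i*}/k_i has one eigenvalue on all nontrivial idempotents.
Hence M is a combination of I and J, with constant entries off the diagonal. -/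
theorem IsPseudocyclic.exists_sum_eq (hS : S.IsPseudocyclic) :
    ∃ t : ℂ, ∀ l, l ≠ 0 → ∑ i, (S.valency i : ℂ)⁻¹ * S.p i (S.star i) l = t := by
  obtain ⟨hcomm, hrank⟩ := hS
  obtain ⟨n, E, hprim, hsum, heig⟩ := hcomm.exists_idempotents
  set M := ∑ i, (S.valency i : ℂ)⁻¹ • (S.adjMat i * S.adjMat (S.star i)) with hM
  have hME : ∀ I, M * E I = ((Fintype.card X : ℂ) / (E I).rank) • E I := fun I =>
    sum_adjMat_mul_star_mul (hprim I).1 (hprim I).2.1 (hprim I).2.2.1 (heig I)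
  have key : ∃ c : ℂ, ∀ I, ∃ y : ℂ, M * E I = c • E I + y • trivialIdempotent X := by
    by_cases h : ∃ J, E J ≠ trivialIdempotent X
    · obtain ⟨J, hJ⟩ := h
      refine ⟨(Fintype.card X : ℂ) / (E J).rank, fun I => ?_⟩
      by_cases hI : E I = trivialIdempotent X
      · refine ⟨(Fintype.card X : ℂ) / (E I).rank - (Fintype.card X : ℂ) / (E J).rank, ?_⟩
        rw [hME, ← hI, ← add_smul, add_sub_cancel]
      · exact ⟨0, by rw [hME, hrank _ _ (hprim I) (hprim J) hI hJ, zero_smul, add_zero]⟩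
    · push Not at h
      exact ⟨0, fun I => ⟨_, by rw [hME, zero_smul, zero_add, h]⟩⟩
  obtain ⟨c, hc⟩ := key
  choose y hy using hc
  have hM1 : M = c • 1 + (∑ I, y I) • trivialIdempotent X := by
    rw [← mul_one M, ← hsum, Finset.mul_sum, Finset.sum_congr rfl fun I _ => hy I,
      Finset.sum_add_distrib, ← Finset.smul_sum, ← Finset.sum_smul]
  refine ⟨(∑ I, y I) * (1 / Fintype.card X), fun l hl => ?_⟩
  obtain ⟨x, z, hxz⟩ := S.nonempty l
  have hne : x ≠ z := fun h => hl (S.rel_unique hxz ((S.diag x z).2 h))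
  have h := congrFun (congrFun hM1 x) z
  rw [hM, Matrix.sum_apply] at h
  simp only [Matrix.smul_apply, Matrix.add_apply, Matrix.one_apply_ne hne, adjMat_mul,
    S.sum_smul_adjMat_apply _ hxz, smul_eq_mul, mul_zero, zero_add] at h
  exact h

/-- In a pseudocyclic scheme the weighted sum of the numbers `p_{i,i*}^l` does not depend on
`l ≠ 0`. -/
theorem IsPseudocyclic.sum_eq (hS : S.IsPseudocyclic) {l : Fin (d + 1)} (hl : l ≠ 0) :
    (∑ i, (S.valency i : ℚ)⁻¹ * S.p i (S.star i) l) * (Fintype.card X - 1) =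
      Fintype.card X - (d + 1) := by
  obtain ⟨t, ht⟩ := hS.exists_sum_eq
  have h1 : ∑ l, (∑ i, (S.valency i : ℂ)⁻¹ * S.p i (S.star i) l) * S.valency l =
      Fintype.card X := by
    simp only [Finset.sum_mul]
    rw [Finset.sum_comm, ← S.sum_valency, Nat.cast_sum]
    refine Finset.sum_congr rfl fun i _ => ?_
    have h2 := S.sum_p_mul_valency i (S.star i)
    rw [valency_star] at h2
    have h3 : ∑ l, (S.p i (S.star i) l : ℂ) * S.valency l = S.valency i * S.valency i := by
      exact_mod_cast h2
    have hk : (S.valency i : ℂ) ≠ 0 := Nat.cast_ne_zero.2 (S.valency_pos i).ne'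
    simp only [mul_assoc, ← Finset.mul_sum, h3]
    field_simp
  -- The constant is found from the k_l-weighted sum over all l, which is |X|: l = 0 contributes d +
  -- 1, the rest t(|X| − 1).
  have h4 : ∑ i, (S.valency i : ℂ)⁻¹ * S.p i (S.star i) 0 = d + 1 := by
    have : ∀ i, (S.valency i : ℂ)⁻¹ * S.p i (S.star i) 0 = 1 := fun i => by
      rw [p_star_zero, inv_mul_cancel₀ (Nat.cast_ne_zero.2 (S.valency_pos i).ne')]
    simp [this]
  have hn : ∑ l, (S.valency l : ℂ) = Fintype.card X := by
    rw [← S.sum_valency, Nat.cast_sum]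
  rw [← Finset.add_sum_erase _ _ (Finset.mem_univ 0)] at h1 hn
  rw [h4, S.valency_zero, Finset.sum_congr rfl fun l hl => by
    rw [ht l (Finset.ne_of_mem_erase hl)], ← Finset.mul_sum] at h1
  rw [S.valency_zero] at hn
  have : (∑ i, (S.valency i : ℂ)⁻¹ * S.p i (S.star i) l) * (Fintype.card X - 1) =
      Fintype.card X - (d + 1) := by
    rw [ht l hl, ← hn]
    push_cast at h1 hn ⊢
    linear_combination h1 - hn
  rw [← Rat.cast_inj (α := ℂ)]
  push_cast
  exact this

end Pseudocyclic

end AssociationScheme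

namespace AssociationScheme

open Finset

/-! ### Pseudocyclic parameters -/

namespace QuadraticPair

set_option linter.unusedSectionVars false

variable {X : Type*} [Fintype X] {d : ℕ} {S : AssociationScheme X d} {i j : Fin (d + 1)}
  (H : S.QuadraticPair i j)
include H

theorem card_classes (huniv : S.pairClosure i j = univ) : d = 4 := by
  have := S.card_pairClosure H.toIndependentPair
  rw [huniv, card_univ, Fintype.card_fin] at this
  omega

theorem card_points (huniv : S.pairClosure i j = univ) :
    Fintype.card X = 1 + 2 * S.valency i + 2 * S.valency j := by
  rw [← S.sum_valency, ← huniv, S.sum_pairClosure H.toIndependentPair, valency_star, valency_star,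
    S.valency_zero]
  ring

theorem sum_inv_valency_mul (huniv : S.pairClosure i j = univ) {l : Fin (d + 1)} (hl : l ≠ 0) :
    ∑ e, (S.valency e : ℚ)⁻¹ * S.p e (S.star e) l =
      2 * (S.valency i : ℚ)⁻¹ * S.p i (S.star i) l +
        2 * (S.valency j : ℚ)⁻¹ * S.p j (S.star j) l := by
  rw [← huniv, S.sum_pairClosure H.toIndependentPair, S.star_zero, p_zero_left, if_neg hl.symm,
    star_star, star_star, valency_star, valency_star, H.comm (S.star i), H.comm (S.star j)]
  push_cast
  ring

/-- With |X| = 1 + 4k, the pseudocyclic sum at l = i reads 8(a + α) = 4k − 4, that is α = h because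
k = 1 + 2a + 2h. For g = h this is 1 and k = 3; for g > h the equations have no solution. -/
theorem parameters_of_isPseudocyclic [DecidableEq X] (hgen : S.Generates i)
    (hk₁ : 1 < S.valency i) (hk : S.valency j ≤ S.valency i) (hS : S.IsPseudocyclic) :
    S.valency i = 3 ∧ S.valency j = 3 ∧ S.p i i i = 0 ∧ S.p i j i = 1 ∧
      S.p i (S.star j) (S.star i) = 1 ∧ S.p i j j = 1 ∧ S.p i (S.star j) j = 0 := by
  obtain ⟨huniv, hcase⟩ := H.parameters hgen hk₁ hk
  have hd : (d : ℚ) = 4 := by exact_mod_cast H.card_classes huniv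
  have hn : (Fintype.card X : ℚ) = 1 + 2 * S.valency i + 2 * S.valency j := by
    exact_mod_cast H.card_points huniv
  have hk0 : (0 : ℚ) < S.valency i := by exact_mod_cast S.valency_pos i
  have hm0 : (0 : ℚ) < S.valency j := by exact_mod_cast S.valency_pos j
  rcases hcase with hf | ⟨hkm, hγ, hcase⟩
  -- If f = k, the sum at l = j is at least 2, too large since 2(|X| − 1) > |X| − 5.
  · exfalso
    have h := hS.sum_eq (S.star_ne_zero_of_ne H.right)
    rw [H.sum_inv_valency_mul huniv (S.star_ne_zero_of_ne H.right), hf, mul_assoc,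
      inv_mul_cancel₀ hk0.ne', hd, hn] at h
    have : (0 : ℚ) ≤ 2 * (S.valency j : ℚ)⁻¹ * S.p j (S.star j) j := by positivity
    nlinarith
  · have hjj : S.p j (S.star j) i = S.p i j j := by
      have := S.p_mul_valency i j j
      rw [hkm] at this
      exact (Nat.eq_of_mul_eq_mul_right (S.valency_pos i) this).symm
    have hαh : S.p i j j = S.p i j i := by
      have h := hS.sum_eq (S.star_ne_zero_of_ne H.left)
      rw [H.sum_inv_valency_mul huniv (S.star_ne_zero_of_ne H.left), H.mul_star_left, hjj, hkm, hd,
        hn, hkm] at h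
      have e : (S.valency i : ℚ) = 1 + 2 * S.p i i i + 2 * S.p i j i := by
        exact_mod_cast H.valency_eq'
      have h2 : (S.valency i : ℚ)⁻¹ * S.valency i = 1 := inv_mul_cancel₀ hk0.ne'
      have h3 : (S.p i j j : ℚ) = S.p i j i := by
        linear_combination h / 8 + e / 2 -
          ((S.p i i i : ℚ) + S.p i j j) * h2
      exact_mod_cast h3
    rcases hcase with ⟨ha, hs, hα⟩ | ⟨s, hs0, hg, h1, h2⟩
    · have e := H.valency_eq'
      omega
    · exfalso
      have hh := H.p_mul_left_pos hgen hk₁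
      rw [hαh, hg] at h1
      generalize S.p i j i = h at *
      generalize S.p i i i = a at *
      -- Eliminating a from sh = (h + s)a then gives h(h − 1) + s(s − 1) = 0, so h = s = 1, and h +
      -- s = 2a + 1 fails by parity.
      have h3 : h + s = 2 * a + 1 := by
        apply Nat.eq_of_mul_eq_mul_left hs0
        linarith
      have h4 : 2 * s * h = (h + s) * (h + s - 1) := by
        rw [mul_assoc, h1, h3]
        simp only [Nat.add_sub_cancel]
        ring
      obtain ⟨h', rfl⟩ := Nat.exists_eq_succ_of_ne_zero hh.ne'
      obtain ⟨s', rfl⟩ := Nat.exists_eq_succ_of_ne_zero hs0.ne'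
      rw [show h'.succ + s'.succ - 1 = h' + s' + 1 by omega] at h4
      simp only [Nat.succ_eq_add_one] at h3 h4
      have h5 : h' = 0 := by nlinarith
      have h6 : s' = 0 := by nlinarith
      omega

end QuadraticPair

end AssociationScheme

/-! ### Uniqueness of the digraph on 13 points -/

/-- The local properties of a pair of relations `A`, `B` that characterise the digraph on
`ZMod 13` in which `A` joins `a` to `a + 1`, `a + 3`, `a + 9` and `B` joins `a` to `a + 2`,
`a + 6`, `a + 5`. -/
structure ThirteenDigraph {X : Type*} (A B : X → X → Prop) : Prop where
  total : ∀ x y, x = y ∨ A x y ∨ A y x ∨ B x y ∨ B y x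
  irrefl_A : ∀ x, ¬ A x x
  irrefl_B : ∀ x, ¬ B x x
  asymm_A : ∀ {x y}, A x y → ¬ A y x
  asymm_B : ∀ {x y}, B x y → ¬ B y x
  not_B : ∀ {x y}, A x y → ¬ B x y
  not_B' : ∀ {x y}, A x y → ¬ B y x
  ncard_out : ∀ x, Set.ncard {z | A x z} = 3
  out_out : ∀ {x y}, A x y → ∃ z, A x z ∧ B y z
  far : ∀ {x y}, A x y → ∃! z, B x z ∧ A y z
  back : ∀ {x y}, A x y → ∃! w, A w x ∧ B w y
  far_back : ∀ {x w}, A w x → ∃! v, B v x ∧ A v w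
  common : ∀ {x y}, B x y → ∃ z, A x z ∧ A y z
  middle : ∀ {x y}, B x y → ∃ z, A x z ∧ A z y
  ncard_paths : ∀ {x y}, A y x → Set.ncard {z | A x z ∧ A z y} = 2
  not_trans : ∀ {x y z}, A x y → A y z → ¬ A x z
  not_B_trans : ∀ {x y z}, A x y → A y z → ¬ B z x
  two_paths : ∀ {x y p q}, A x p → A p y → A x q → A q y → p ≠ q → A y x
  not_far : ∀ {x z v}, B x z → B v x → ¬ A v z
  far_far : ∀ {x z}, B x z → ∃ t, B x t ∧ A z t
  far_farBack : ∀ {x z}, B x z → ∃ t, B t x ∧ A z t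
  farBack_farBack : ∀ {x v}, B v x → ∃ t, B t x ∧ A v t
  back_far : ∀ {x w}, A w x → ∃ t, B x t ∧ A w t
  back_farBack : ∀ {x w}, A w x → ∃ t, B t x ∧ A w t

namespace ThirteenDigraph

variable {X : Type*}

theorem ncard_triple {p q r : X} (h1 : p ≠ q) (h2 : p ≠ r) (h3 : q ≠ r) :
    Set.ncard {p, q, r} = 3 := by
  rw [Set.ncard_eq_three]
  exact ⟨p, q, r, h1, h2, h3, rfl⟩

variable {A B : X → X → Prop} (D : ThirteenDigraph A B)
include D

theorem out_eq [Finite X] {x p q r : X} (hp : A x p) (hq : A x q) (hr : A x r) (h1 : p ≠ q)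
    (h2 : p ≠ r) (h3 : q ≠ r) {t : X} (ht : A x t) : t = p ∨ t = q ∨ t = r := by
  have : ({p, q, r} : Set X) = {z | A x z} := by
    refine Set.eq_of_subset_of_ncard_le ?_ ?_
    · rintro _ (rfl | rfl | rfl) <;> assumption
    · rw [D.ncard_out, ncard_triple h1 h2 h3]
  have ht' : t ∈ ({p, q, r} : Set X) := this ▸ ht
  simpa using ht'

/-- Each of the three out-neighbours of x has a B-successor among them. With no loops and no
2-cycles, these successors form a directed 3-cycle. -/
theorem exists_cycle [Finite X] (x : X) :
    ∃ y : Fin 3 → X, (∀ i, A x (y i)) ∧ (∀ i, B (y i) (y (i + 1))) ∧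
      ∀ t, A x t → ∃ i, t = y i := by
  have hne : {z | A x z}.Nonempty := Set.nonempty_of_ncard_ne_zero (by rw [D.ncard_out]; simp)
  obtain ⟨p, hp⟩ := hne
  obtain ⟨q, hq, hpq⟩ := D.out_out hp
  obtain ⟨r, hr, hqr⟩ := D.out_out hq
  obtain ⟨s, hs, hrs⟩ := D.out_out hr
  have h1 : p ≠ q := by rintro rfl; exact D.irrefl_B _ hpq
  have h2 : q ≠ r := by rintro rfl; exact D.irrefl_B _ hqr
  have h3 : p ≠ r := by rintro rfl; exact D.asymm_B hpq hqr
  have hout := fun t (ht : A x t) => D.out_eq hp hq hr h1 h3 h2 ht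
  have hsp : s = p := by
    rcases hout s hs with rfl | rfl | rfl
    · rfl
    · exact absurd hrs (D.asymm_B hqr)
    · exact absurd hrs (D.irrefl_B _)
  subst hsp
  refine ⟨![s, q, r], ?_, ?_, ?_⟩
  · intro i
    fin_cases i
    exacts [hp, hq, hr]
  · intro i
    fin_cases i
    exacts [hpq, hqr, hrs]
  · intro t ht
    rcases hout t ht with rfl | rfl | rfl
    exacts [⟨0, rfl⟩, ⟨1, rfl⟩, ⟨2, rfl⟩]

/-- In the model with x = 0 the labels are y_i = 3^i, z_i = 2·3^i, w_i = −3^i, v_i = −2·3^i, and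
adding 1 to the index is multiplication by 3. Each arc is obtained by listing the possible endpoints
and eliminating all but one. -/
theorem exists_labelling [Finite X] (x : X) :
    ∃ y z w v : Fin 3 → X,
      ((∀ i, A x (y i)) ∧ (∀ i, A (w i) x) ∧ (∀ i j, i ≠ j → A (y i) (w j)) ∧
        (∀ i, A (y i) (z i)) ∧ (∀ i, A (z i) (y (i + 1))) ∧ (∀ i, A (z i) (z (i + 2))) ∧
        (∀ i, A (z i) (v i)) ∧ (∀ i, A (w i) (z i)) ∧ (∀ i, A (w i) (v (i + 2))) ∧
        (∀ i, A (v i) (w i)) ∧ (∀ i, A (v i) (y i)) ∧ ∀ i, A (v i) (v (i + 1))) ∧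
      ∀ t, t = x ∨ ∃ i, t = y i ∨ t = z i ∨ t = w i ∨ t = v i := by
  have tri : ∀ i j : Fin 3, j = i ∨ j = i + 1 ∨ j = i + 2 := by decide
  have add_one_ne : ∀ i : Fin 3, i + 1 ≠ i := by decide
  have add_one_ne_add_two : ∀ i : Fin 3, i + 1 ≠ i + 2 := by decide
  have add_two_add_one : ∀ i : Fin 3, i + 2 + 1 = i := by decide
  obtain ⟨y, hxy, hyy, hy⟩ := D.exists_cycle x
  choose z hz hz' using fun i => D.far (hxy i)
  choose w hw hw' using fun i => D.back (hxy i)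
  simp only at hz hz' hw hw'
  choose v hv hv' using fun i => D.far_back (hw i).1
  simp only at hv hv'
  have hzs : ∀ t, B x t → ∃ i, t = z i := by
    intro t ht
    obtain ⟨s, hs, hst⟩ := D.middle ht
    obtain ⟨i, rfl⟩ := hy s hs
    exact ⟨i, hz' i t ⟨ht, hst⟩⟩
  have hws : ∀ t, A t x → ∃ i, t = w i := by
    intro t ht
    obtain ⟨s, ⟨hs, hst⟩, -⟩ := D.far ht
    obtain ⟨i, rfl⟩ := hy s hst
    exact ⟨i, hw' i t ⟨ht, hs⟩⟩
  have hvs : ∀ t, B t x → ∃ i, t = v i := by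
    intro t ht
    obtain ⟨s, hs, hst⟩ := D.middle ht
    obtain ⟨i, rfl⟩ := hws s hst
    exact ⟨i, hv' i t ⟨ht, hs⟩⟩
  have hwx : ∀ i, A (w i) x := fun i => (hw i).1
  have hyz : ∀ i, A (y i) (z i) := fun i => (hz i).2
  have hvw : ∀ i, A (v i) (w i) := fun i => (hv i).2
  have hyw : ∀ i j, i ≠ j → A (y i) (w j) := by
    intro i j hij
    -- There are exactly two paths from y_i back to x. They run through the w's, and w_i is excluded
    -- because B joins it to y_i.
    have : {t | A (y i) t ∧ A t x} = ({w (i + 1), w (i + 2)} : Set X) := by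
      refine Set.eq_of_subset_of_ncard_le ?_ ?_
      · rintro t ⟨h1, h2⟩
        obtain ⟨l, rfl⟩ := hws t h2
        rcases tri i l with rfl | rfl | rfl
        · exact absurd (hw _).2 (D.not_B' h1)
        · simp
        · simp
      · rw [D.ncard_paths (hxy i)]
        exact (Set.ncard_insert_le _ _).trans (by rw [Set.ncard_singleton])
    have hj : w j ∈ ({w (i + 1), w (i + 2)} : Set X) := by
      rcases tri i j with rfl | rfl | rfl
      · exact absurd rfl hij
      · simp
      · simp
    rw [← this] at hj
    exact hj.1
  have hvy : ∀ i, A (v i) (y i) := by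
    intro i
    obtain ⟨t, h1, h2⟩ := D.common (hv i).1
    obtain ⟨j, rfl⟩ := hy t h2
    rcases eq_or_ne j i with rfl | hji
    · exact h1
    · exact absurd (hvw i) (D.not_trans h1 (hyw j i hji))
  have hzy : ∀ i, A (z i) (y (i + 1)) := by
    intro i
    obtain ⟨t, h1, h2⟩ := D.common (hz i).1
    obtain ⟨j, rfl⟩ := hy t h1
    rcases tri i j with rfl | rfl | rfl
    · exact absurd (hyz _) (D.asymm_A h2)
    · exact h2
    · have := hyy (i + 2)
      rw [add_two_add_one] at this
      exact absurd this (D.not_B_trans (hyz i) h2)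
  have hzz : ∀ i, A (z i) (z (i + 2)) := by
    intro i
    obtain ⟨t, h1, h2⟩ := D.far_far (hz i).1
    obtain ⟨j, rfl⟩ := hzs t h1
    rcases tri i j with rfl | rfl | rfl
    · exact absurd h2 (D.irrefl_A _)
    · exact absurd h2 (D.not_trans (hzy i) (hyz _))
    · exact h2
  have hwz : ∀ i, A (w i) (z i) := by
    intro i
    obtain ⟨t, h1, h2⟩ := D.back_far (hwx i)
    obtain ⟨j, rfl⟩ := hzs t h1
    rcases eq_or_ne j i with rfl | hji
    · exact h2
    · exact absurd (hyz j) (D.not_trans (hyw j i hji) h2)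
  have hyv : ∀ i j, y i ≠ v j := fun i j e => D.not_B' (hxy i) (e ▸ (hv j).1)
  have hzv : ∀ i j, z i ≠ v j := fun i j e => D.asymm_B (hz i).1 (e ▸ (hv j).1)
  have hzv' : ∀ i, A (z i) (v i) := by
    intro i
    obtain ⟨t, h1, h2⟩ := D.far_farBack (hz i).1
    obtain ⟨j, rfl⟩ := hvs t h1
    rcases tri i j with rfl | rfl | rfl
    · exact h2
    · exact absurd (hzy i) (D.not_trans h2 (hvy _))
    · have := D.two_paths (hzy i) (hyw (i + 1) (i + 2) (add_one_ne_add_two i)) h2 (hvw _) (hyv _ _)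
      exact absurd (hwz _) (D.not_trans this (hzz i))
  have hvv : ∀ i, A (v i) (v (i + 1)) := by
    intro i
    obtain ⟨t, h1, h2⟩ := D.farBack_farBack (hv i).1
    obtain ⟨j, rfl⟩ := hvs t h1
    rcases tri i j with rfl | rfl | rfl
    · exact absurd h2 (D.irrefl_A _)
    · exact h2
    · have := D.two_paths (hzz i) (hzv' _) (hzv' i) h2 (hzv _ _)
      exact absurd this (D.not_far (hz i).1 h1)
  have hwv : ∀ i, A (w i) (v (i + 2)) := by
    intro i
    obtain ⟨t, h1, h2⟩ := D.back_farBack (hwx i)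
    obtain ⟨j, rfl⟩ := hvs t h1
    rcases tri i j with rfl | rfl | rfl
    · exact absurd h2 (D.asymm_A (hvw _))
    · exfalso
      -- An arc w_i → v_{i+1} would produce a third path from w_i to y_{i+1}, where only two exist.
      have hle : ({x, z i, v (i + 1)} : Set X).ncard ≤
          {t | A (w i) t ∧ A t (y (i + 1))}.ncard := by
        refine Set.ncard_le_ncard ?_
        rintro _ (rfl | rfl | rfl)
        exacts [⟨hwx i, hxy _⟩, ⟨hwz i, hzy i⟩, ⟨h2, hvy _⟩]
      rw [D.ncard_paths (hyw _ _ (add_one_ne i)), ncard_triple] at hle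
      · omega
      · exact fun e => D.irrefl_B x (by simpa [← e] using (hz i).1)
      · exact fun e => D.irrefl_B x (by simpa [← e] using h1)
      · exact hzv _ _
    · exact h2
  refine ⟨y, z, w, v, ⟨hxy, hwx, hyw, hyz, hzy, hzz, hzv', hwz, hwv, hvw, hvy, hvv⟩, ?_⟩
  intro t
  rcases D.total x t with h | h | h | h | h
  · exact Or.inl h.symm
  · obtain ⟨i, hi⟩ := hy t h
    exact Or.inr ⟨i, Or.inl hi⟩
  · obtain ⟨i, hi⟩ := hws t h
    exact Or.inr ⟨i, Or.inr (Or.inr (Or.inl hi))⟩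
  · obtain ⟨i, hi⟩ := hzs t h
    exact Or.inr ⟨i, Or.inr (Or.inl hi)⟩
  · obtain ⟨i, hi⟩ := hvs t h
    exact Or.inr ⟨i, Or.inr (Or.inr (Or.inr hi))⟩

theorem exists_equiv [Fintype X] (hcard : Fintype.card X = 13) :
    ∃ φ : ZMod 13 ≃ X, ∀ a b, A (φ a) (φ b) ↔ b = a + 1 ∨ b = a + 3 ∨ b = a + 9 := by
  have : Nonempty X := Fintype.card_pos_iff.1 (by omega)
  obtain ⟨x⟩ := this
  obtain ⟨y, z, w, v, ⟨hxy, hwx, hyw, hyz, hzy, hzz, hzv, hwz, hwv, hvw, hvy, hvv⟩, hall⟩ :=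
    D.exists_labelling x
  -- Position r holds the point whose model value is r: y at 1, 3, 9, z at 2, 6, 5, w at 12, 10, 4
  -- and v at 11, 7, 8.
  let φ : Fin 13 → X :=
    ![x, y 0, z 0, y 1, w 2, z 2, z 1, v 1, v 2, y 2, w 1, v 0, w 0]
  have hsurj : Function.Surjective φ := by
    intro t
    rcases hall t with rfl | ⟨i, rfl | rfl | rfl | rfl⟩
    · exact ⟨0, rfl⟩
    · fin_cases i
      exacts [⟨1, rfl⟩, ⟨3, rfl⟩, ⟨9, rfl⟩]
    · fin_cases i
      exacts [⟨2, rfl⟩, ⟨6, rfl⟩, ⟨5, rfl⟩]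
    · fin_cases i
      exacts [⟨12, rfl⟩, ⟨10, rfl⟩, ⟨4, rfl⟩]
    · fin_cases i
      exacts [⟨11, rfl⟩, ⟨7, rfl⟩, ⟨8, rfl⟩]
  have hbij : Function.Bijective φ :=
    (Fintype.bijective_iff_surjective_and_card φ).2 ⟨hsurj, by simp [hcard]⟩
  have h1 : ∀ a : Fin 13, A (φ a) (φ (a + 1)) := by
    intro a
    fin_cases a
    exacts [hxy 0, hyz 0, hzy 0, hyw 1 2 (by decide), hwz 2, hzz 2, hzv 1, hvv 1, hvy 2,
      hyw 2 1 (by decide), hwv 1, hvw 0, hwx 0]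
  have h3 : ∀ a : Fin 13, A (φ a) (φ (a + 3)) := by
    intro a
    fin_cases a
    exacts [hxy 1, hyw 0 2 (by decide), hzz 0, hyz 1, hwv 2, hzv 2, hzy 1, hvw 1, hvv 2,
      hyw 2 0 (by decide), hwx 1, hvy 0, hwz 0]
  have h9 : ∀ a : Fin 13, A (φ a) (φ (a + 9)) := by
    intro a
    fin_cases a
    exacts [hxy 2, hyw 0 1 (by decide), hzv 0, hyw 1 0 (by decide), hwx 2, hzy 2, hzz 1, hvy 1,
      hvw 2, hyz 2, hwz 1, hvv 0, hwv 0]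
  refine ⟨Equiv.ofBijective φ hbij, fun (a b : Fin 13) => ?_⟩
  change A (φ a) (φ b) ↔ b = a + 1 ∨ b = a + 3 ∨ b = a + 9
  constructor
  · intro h
    have hd : ∀ a : Fin 13, a + 1 ≠ a + 3 ∧ a + 1 ≠ a + 9 ∧ a + 3 ≠ a + 9 := by decide
    have := D.out_eq (h1 a) (h3 a) (h9 a) (hbij.1.ne (hd a).1) (hbij.1.ne (hd a).2.1)
      (hbij.1.ne (hd a).2.2) h
    simpa only [hbij.1.eq_iff] using this
  · rintro (rfl | rfl | rfl)
    exacts [h1 a, h3 a, h9 a]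

end ThirteenDigraph

/-! ### Identification with the cyclotomic scheme -/

namespace AssociationScheme

open Finset

section Iso

variable {X : Type*} [Fintype X] {d : ℕ} {S : AssociationScheme X d}

theorem existsUnique_of_p_eq_one {i j l : Fin (d + 1)} (h : S.p i j l = 1) {x y : X}
    (hl : S.R l x y) : ∃! z, S.R i x z ∧ S.R j z y := by
  rw [← S.inter i j l x y hl, Set.ncard_eq_one] at h
  obtain ⟨z, hz⟩ := h
  have hz' : ∀ t, (S.R i x t ∧ S.R j t y) ↔ t = z := fun t => by
    simpa using Set.ext_iff.1 hz t
  exact ⟨z, (hz' z).2 rfl, fun t ht => (hz' t).1 ht⟩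

/-- A bijection that maps every relation into some relation is an isomorphism, if the numbers of
relations agree. -/
theorem isIsomorphic_of_forall_exists {Y : Type*} [Fintype Y] {T : AssociationScheme Y d}
    (f : X ≃ Y) (h : ∀ i, ∃ k, ∀ x y, S.R i x y → T.R k (f x) (f y)) : S.IsIsomorphic T := by
  choose σ hσ using h
  have hsurj : Function.Surjective σ := by
    intro k
    obtain ⟨u, v, huv⟩ := T.nonempty k
    obtain ⟨i, hi⟩ := S.exists_rel (f.symm u) (f.symm v)
    have := hσ i _ _ hi
    rw [Equiv.apply_symm_apply, Equiv.apply_symm_apply] at this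
    exact ⟨i, T.rel_unique this huv⟩
  have hbij : Function.Bijective σ := Finite.injective_iff_bijective.1
    (Finite.injective_iff_surjective.2 hsurj)
  refine ⟨f, Equiv.ofBijective σ hbij, fun i x y => ⟨hσ i x y, fun h => ?_⟩⟩
  obtain ⟨l, hl⟩ := S.exists_rel x y
  have := T.rel_unique (hσ l x y hl) h
  rwa [← hbij.1 this]

end Iso

theorem mem_zpowers_pow_four {α : (ZMod 13)ˣ} (hα : ∀ u : (ZMod 13)ˣ, u ∈ Subgroup.zpowers α)
    {t : (ZMod 13)ˣ} (ht : t ^ 3 = 1) : t ∈ Subgroup.zpowers (α ^ 4) := by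
  have hord : orderOf α = 12 := by
    rw [orderOf_eq_card_of_forall_mem_zpowers hα, Nat.card_eq_fintype_card,
      ZMod.card_units_eq_totient]
    decide
  obtain ⟨n, rfl⟩ := Subgroup.mem_zpowers_iff.1 (hα t)
  rw [← zpow_natCast, ← zpow_mul, ← orderOf_dvd_iff_zpow_eq_one, hord] at ht
  obtain ⟨m, hm⟩ : (4 : ℤ) ∣ n := by
    push_cast at ht
    omega
  refine Subgroup.mem_zpowers_iff.2 ⟨m, ?_⟩
  rw [hm, ← zpow_natCast, ← zpow_mul]
  rfl

/-- The cosets of the cubic roots of unity lie in relations of `Cyc(13, 4)`. -/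
theorem exists_cyclotomicRel_of_coset {α : (ZMod 13)ˣ}
    (hα : ∀ u : (ZMod 13)ˣ, u ∈ Subgroup.zpowers α) (c : (ZMod 13)ˣ) :
    ∃ k : Fin 5, ∀ x y : ZMod 13, (x - y = c ∨ x - y = 3 * c ∨ x - y = 9 * c) →
      cyclotomicRel α 4 k x y := by
  obtain ⟨k, ⟨hk, w, hw, hc⟩, -⟩ := cyclotomic_existsUnique hα four_dvd_card_zmod_thirteen c
  have key : ∀ t : (ZMod 13)ˣ, t ^ 3 = 1 → ∀ x y : ZMod 13, x - y = t * c →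
      cyclotomicRel α 4 k x y := by
    intro t ht x y h
    rw [cyclotomicRel, if_neg hk]
    refine ⟨t * w, mul_mem (mem_zpowers_pow_four hα ht) hw, ?_⟩
    rw [h, ← Units.val_mul, hc, mul_left_comm]
  -- The nontrivial cube roots of unity modulo 13, inverse to each other.
  let r : (ZMod 13)ˣ := ⟨3, 9, by decide, by decide⟩
  let s : (ZMod 13)ˣ := ⟨9, 3, by decide, by decide⟩
  refine ⟨k, fun x y h => ?_⟩
  rcases h with h | h | h
  · exact key 1 (one_pow 3) x y (by simpa using h)
  · exact key r (by decide) x y h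
  · exact key s (by decide) x y h

namespace QuadraticPair

variable {X : Type*} [Fintype X] {d : ℕ} {S : AssociationScheme X d} {i j : Fin (d + 1)}
  (H : S.QuadraticPair i j)
include H

/-- The given values force b = 2 and c = f = p_{ij}^{j*} = 1. Apart from the elementary conditions,
each property expresses that some intersection number is 0, 1 or 2. -/
theorem thirteenDigraph (huniv : S.pairClosure i j = univ) (hk : S.valency i = 3)
    (hm : S.valency j = 3) (ha : S.p i i i = 0) (hh : S.p i j i = 1)
    (hg : S.p i (S.star j) (S.star i) = 1) (hα : S.p i j j = 1)
    (hγ : S.p i (S.star j) j = 0) : ThirteenDigraph (S.R i) (S.R j) := by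
  have hb : S.p i i (S.star i) = 2 := by
    have := H.valency_eq
    omega
  have hc : S.p i i j = 1 := by
    have := H.sq_right_mul
    rw [hm, hk, hg] at this
    omega
  have hf : S.p i (S.star i) j = 1 := by
    have := H.mul_star_right_mul
    rw [hm, hk, hh] at this
    omega
  have hβ : S.p i j (S.star j) = 1 := by
    have := H.assoc_star_right
    rw [hc, hf, hb, hγ, hα] at this
    omega
  have T : ∀ e {x y}, S.R (S.star e) x y ↔ S.R e y x := fun e {x y} => S.transpose e x y
  have ne : ∀ {e f x y}, S.R e x y → e ≠ f → ¬ S.R f x y := fun h1 h2 h3 =>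
    h2 (S.rel_unique h1 h3)
  have hcases : ∀ l, l = 0 ∨ l = i ∨ l = S.star i ∨ l = j ∨ l = S.star j := fun l =>
    S.mem_pairClosure.1 (by rw [huniv]; exact mem_univ l)
  have hsq0 := H.sq_zero
  have hsq2 := H.sq_star_right
  constructor
  case total =>
    intro x y
    obtain ⟨l, hl⟩ := S.exists_rel x y
    rcases hcases l with rfl | rfl | rfl | rfl | rfl
    · exact Or.inl ((S.diag x y).1 hl)
    · exact Or.inr (Or.inl hl)
    · exact Or.inr (Or.inr (Or.inl ((T _).1 hl)))
    · exact Or.inr (Or.inr (Or.inr (Or.inl hl)))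
    · exact Or.inr (Or.inr (Or.inr (Or.inr ((T _).1 hl))))
  case irrefl_A => exact fun x => ne ((S.diag x x).2 rfl) (S.star_ne_zero_of_ne H.left).symm
  case irrefl_B => exact fun x => ne ((S.diag x x).2 rfl) (S.star_ne_zero_of_ne H.right).symm
  case asymm_A => exact fun h h' => ne h H.left ((T _).2 h')
  case asymm_B => exact fun h h' => ne h H.right ((T _).2 h')
  case not_B => exact fun h => ne h H.ne.symm
  case not_B' => exact fun h h' => ne h H.ne_star' ((T _).2 h')
  case ncard_out => exact fun x => (S.ncard_rel i x).trans hk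
  case out_out =>
    intro x y h
    obtain ⟨z, h1, h2⟩ := (existsUnique_of_p_eq_one (H.mul_star_right_left.trans hh) h).exists
    exact ⟨z, h1, (T _).1 h2⟩
  case far =>
    intro x y h
    have := existsUnique_of_p_eq_one ((H.star_mul_right i).trans hg) h
    simpa only [T] using this
  case back =>
    intro x y h
    have e : S.p (S.star i) j i = 1 := by
      rw [S.p_star_comm H.comm, S.star_star, hg]
    simpa only [T] using existsUnique_of_p_eq_one e h
  case far_back =>
    intro x w h
    have e : S.p (S.star j) i (S.star i) = 1 := by rw [H.comm, hg]
    simpa only [T] using existsUnique_of_p_eq_one e ((T _).2 h)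
  case common =>
    intro x y h
    simpa only [T] using (existsUnique_of_p_eq_one hf h).exists
  case middle => exact fun h => (existsUnique_of_p_eq_one hc h).exists
  case ncard_paths => exact fun {x y} h => (S.inter i i _ x y ((T _).2 h)).trans hb
  case not_trans => exact fun h1 h2 h3 => S.p_pos_of_rel h3 h1 h2 ha
  case not_B_trans => exact fun h1 h2 h3 => S.p_pos_of_rel ((T _).2 h3) h1 h2 hsq2
  case two_paths =>
    intro x y p q h1 h2 h3 h4 hpq
    obtain ⟨l, hl⟩ := S.exists_rel x y
    rcases hcases l with rfl | rfl | rfl | rfl | rfl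
    · exact absurd hsq0 (S.p_pos_of_rel hl h1 h2)
    · exact absurd ha (S.p_pos_of_rel hl h1 h2)
    · exact (T _).1 hl
    · exact absurd ((existsUnique_of_p_eq_one hc hl).unique ⟨h1, h2⟩ ⟨h3, h4⟩) hpq
    · exact absurd hsq2 (S.p_pos_of_rel hl h1 h2)
  case not_far =>
    intro x z v h1 h2 h3
    refine S.p_pos_of_rel h1 ((T j).2 h2) h3 ?_
    rw [H.comm, hγ]
  case far_far =>
    intro x z h
    have e : S.p j (S.star i) j = 1 := by
      rw [H.star_mul_right, H.mul_star_right_star_right, hα]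
    simpa only [T] using (existsUnique_of_p_eq_one e h).exists
  case far_farBack =>
    intro x z h
    have e : S.p (S.star j) (S.star i) j = 1 := by
      rw [H.comm, S.p_star_comm H.comm, S.star_star, S.star_star, hβ]
    simpa only [T] using (existsUnique_of_p_eq_one e h).exists
  case farBack_farBack =>
    intro x v h
    have e : S.p (S.star j) (S.star i) (S.star j) = 1 := by
      rw [← S.p_star_comm H.comm, H.comm, hα]
    simpa only [T] using (existsUnique_of_p_eq_one e ((T _).2 h)).exists
  case back_far =>
    intro x w h
    have e : S.p j (S.star i) (S.star i) = 1 := by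
      rw [H.star_mul_right, S.star_star, H.mul_star_right_left, hh]
    simpa only [T] using (existsUnique_of_p_eq_one e ((T _).2 h)).exists
  case back_farBack =>
    intro x w h
    have e : S.p (S.star j) (S.star i) (S.star i) = 1 := by
      rw [← S.p_star_comm H.comm, H.comm, hh]
    simpa only [T] using (existsUnique_of_p_eq_one e ((T _).2 h)).exists

omit H in
theorem isIsomorphic_cyclotomicScheme {S : AssociationScheme X 4} {i j : Fin 5}
    (H : S.QuadraticPair i j) (huniv : S.pairClosure i j = univ)
    (hcard : Fintype.card X = 13) (D : ThirteenDigraph (S.R i) (S.R j)) (α : (ZMod 13)ˣ)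
    (hα : ∀ u : (ZMod 13)ˣ, u ∈ Subgroup.zpowers α) :
    S.IsIsomorphic (cyclotomicScheme α hα 4 four_dvd_card_zmod_thirteen) := by
  obtain ⟨φ, hφ⟩ := D.exists_equiv hcard
  -- The sign is needed because φ describes R_i by target minus source, while the cyclotomic
  -- relations use source minus target.
  let ψ : X ≃ ZMod 13 := φ.symm.trans (Equiv.neg _)
  have hψ : ∀ x, ψ x = -φ.symm x := fun x => rfl
  have hA : ∀ x y, S.R i x y → ψ x - ψ y = 1 ∨ ψ x - ψ y = 3 ∨ ψ x - ψ y = 9 := by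
    intro x y h
    rw [← φ.apply_symm_apply x, ← φ.apply_symm_apply y, hφ] at h
    rw [hψ, hψ]
    rcases h with h | h | h <;> rw [h] <;> ring_nf <;> simp
  have hB : ∀ x y, S.R j x y → ψ x - ψ y = 2 ∨ ψ x - ψ y = 6 ∨ ψ x - ψ y = 5 := by
    intro x y h
    obtain ⟨z, h1, h2⟩ := D.middle h
    have hne : ψ x - ψ y ≠ 0 := fun e => D.irrefl_B x (by
      have := ψ.injective (sub_eq_zero.1 e)
      rwa [← this] at h)
    have h3 : ψ x - ψ y = (ψ x - ψ z) + (ψ z - ψ y) := by ring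
    have hnot : ¬ (ψ x - ψ y = -1 ∨ ψ x - ψ y = -3 ∨ ψ x - ψ y = -9) := by
      intro e
      refine D.not_B' (x := y) (y := x) ?_ h
      rw [← φ.apply_symm_apply x, ← φ.apply_symm_apply y, hφ]
      rw [hψ, hψ] at e
      rcases e with e | e | e
      · exact Or.inl (by linear_combination -e)
      · exact Or.inr (Or.inl (by linear_combination -e))
      · exact Or.inr (Or.inr (by linear_combination -e))
    -- R_j lies in R_i R_i and avoids the transpose of R_i. Sums of two elements of {1, 3, 9} are 2,
    -- 6, 5 or their negatives −1, −3, −9, so 2, 6, 5 remain.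
    have dec : ∀ u s t : ZMod 13, (s = 1 ∨ s = 3 ∨ s = 9) → (t = 1 ∨ t = 3 ∨ t = 9) → u = s + t →
        ¬ (u = -1 ∨ u = -3 ∨ u = -9) → u = 2 ∨ u = 6 ∨ u = 5 := by
      rintro u s t (rfl | rfl | rfl) (rfl | rfl | rfl) rfl <;> decide
    exact dec _ _ _ (hA x z h1) (hA z y h2) h3 hnot
  refine isIsomorphic_of_forall_exists ψ fun e => ?_
  have he : e ∈ S.pairClosure i j := by rw [huniv]; exact mem_univ e
  change ∃ k : Fin 5, ∀ x y, S.R e x y → cyclotomicRel α 4 k (ψ x) (ψ y)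
  let two : (ZMod 13)ˣ := ⟨2, 7, by decide, by decide⟩
  have neg : ∀ u v t : ZMod 13, v - u = t → u - v = -t := fun u v t h => by rw [← h]; ring
  rcases S.mem_pairClosure.1 he with rfl | rfl | rfl | rfl | rfl
  · exact ⟨0, fun x y h => by simp [cyclotomicRel, (S.diag x y).1 h]⟩
  · obtain ⟨k, hk⟩ := exists_cyclotomicRel_of_coset hα 1
    exact ⟨k, fun x y h => hk _ _ (by simpa using hA x y h)⟩
  · obtain ⟨k, hk⟩ := exists_cyclotomicRel_of_coset hα (-1)
    refine ⟨k, fun x y h => hk _ _ ?_⟩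
    rcases hA y x ((S.transpose _ x y).1 h) with h | h | h
    · exact Or.inl (by simpa using neg _ _ _ h)
    · exact Or.inr (Or.inl (by simpa using neg _ _ _ h))
    · exact Or.inr (Or.inr (by simpa using neg _ _ _ h))
  · obtain ⟨k, hk⟩ := exists_cyclotomicRel_of_coset hα two
    refine ⟨k, fun x y h => hk _ _ ?_⟩
    rcases hB x y h with h | h | h
    · exact Or.inl h
    · exact Or.inr (Or.inl (h.trans (by decide)))
    · exact Or.inr (Or.inr (h.trans (by decide)))
  · obtain ⟨k, hk⟩ := exists_cyclotomicRel_of_coset hα (-two)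
    refine ⟨k, fun x y h => hk _ _ ?_⟩
    rcases hB y x ((S.transpose _ x y).1 h) with h | h | h
    · exact Or.inl (neg _ _ _ h)
    · exact Or.inr (Or.inl ((neg _ _ _ h).trans (by decide)))
    · exact Or.inr (Or.inr ((neg _ _ _ h).trans (by decide)))

end QuadraticPair

end AssociationScheme

theorem theorem1p1 {X : Type*} [Fintype X] [DecidableEq X] {d : ℕ} (S : AssociationScheme X d)
    (hcomm : S.IsCommutative)
    (hgen : S.Generates 1)
    (hnonsymm : ¬ S.IsSymmRel 1)
    (hk₁ : 1 < S.valency 1)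
    (hsq : S.relMul {1} {1} ⊆ {1, S.star 1, 2})
    (hmul : S.relMul {1} {S.star 1} ⊆ {0, 1, S.star 1, 2, S.star 2})
    (htwo : 2 ≠ S.star 1 ∧ 2 ≠ S.star 2)
    (hk : S.valency 2 ≤ S.valency 1) :
    d = 4 ∧
      (S.IsPseudocyclic →
        ∀ (α : (ZMod 13)ˣ) (hα : ∀ u : (ZMod 13)ˣ, u ∈ Subgroup.zpowers α),
          S.IsIsomorphic (cyclotomicScheme α hα 4 four_dvd_card_zmod_thirteen)) := by
  -- Numerals in `Fin (d + 1)` are read modulo d + 1: for d = 0 all relations coincide, against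
  -- non-symmetry, and for d = 1 the numeral 2 is 0.
  have h21 : (2 : Fin (d + 1)) ≠ 1 := by
    intro h
    have h' := congrArg Fin.val h
    rcases d with _ | _ | d
    · exact hnonsymm (Subsingleton.elim (α := Fin 1) _ _)
    · exact absurd h (by decide)
    · change 2 % (d + 1 + 1 + 1) = 1 % (d + 1 + 1 + 1) at h'
      rw [Nat.mod_eq_of_lt (by omega), Nat.mod_eq_of_lt (by omega)] at h'
      omega
  have H : S.QuadraticPair 1 2 :=
    { left := hnonsymm
      right := htwo.2
      ne := h21
      ne_star := htwo.1
      comm := hcomm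
      sq := fun l hl => by
        have : l ∈ S.relMul {1} {1} := by simpa [AssociationScheme.relMul] using hl
        simpa using hsq this
      mul_star := fun l hl => by
        have : l ∈ S.relMul {1} {S.star 1} := by simpa [AssociationScheme.relMul] using hl
        exact hmul this }
  have huniv := (H.parameters hgen hk₁ hk).1
  refine ⟨H.card_classes huniv, fun hS α hα => ?_⟩
  obtain ⟨hk3, hm3, ha, hh, hg, hα1, hγ⟩ := H.parameters_of_isPseudocyclic hgen hk₁ hk hS
  have D := H.thirteenDigraph huniv hk3 hm3 ha hh hg hα1 hγ
  have hcard := H.card_points huniv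
  rw [hk3, hm3] at hcard
  obtain rfl := H.card_classes huniv
  exact H.isIsomorphic_cyclotomicScheme huniv hcard D α hα
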